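/- All digraphs are finite. For a digraph $D$ and a vertex $v$, the semi-cuts of $v$ are the set of arcs leaving $v$ and the set of arcs entering $v$. An arc-coloring $\varphi:A(D)\to[k]$ satisfies the weak-odd condition at $v$ if $v$ is isolated or there is a color $i\in[k]$ that occurs an odd number of times on each nonempty semi-cut of $v$ (the same $i$ for both). The weak-odd chromatic index $\chi'_{\mathrm{wo}}(D)$ is the least $k$ for which some $\varphi:A(D)\to[k]$ satisfies the condition at every vertex, and the defect $\mathrm{def}(D)$ is the minimum, over all $\varphi:A(D)\to[2]$, of the number of vertices at which the condition fails. Let $T$ be a tournament with vertices $v_1,\dots,v_n$, and let $ET$ be the extended tournament obtained from $T$ by blowing up each $v_i$ into a nonempty finite independent set $I_i$ (with all arcs from $I_i$ to $I_j$ whenever $v_iv_j\in A(T)$, and no other arcs). Call $ET$ bad if $n>3$, $|V(ET)|$ is odd, exactly one of the sets $I_1,\dots,I_n$, say $I_m$, has even size, every vertex of $N_T^+(v_m)$ dominates every vertex of $N_T^-(v_m)$ in $T$, and $|N_T^-(v_m)|=1$ or $|N_T^+(v_m)|=1$. **Proposition 4.7.** For every extended tournament $ET$, $$\mathrm{def}(ET)=\begin{cases}1&\text{if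 (all } |I_i| \text{ are odd and } \chi'_{\mathrm{wo}}(T)=3)\text{ or } ET\text{ is bad},\\0&\text{otherwise.}\end{cases}$$ -/

import Mathlib

namespace Digraph

universe u w

variable {V : Type u}

/-- The arcs of a digraph, as ordered pairs of vertices. -/
def Arc (D : Digraph V) : Type u := {p : V × V // D.Adj p.1 p.2}

/-- The set of out-neighbours of `v`. -/
def outNbrs (D : Digraph V) (v : V) : Set V := {x | D.Adj v x}

/-- The set of in-neighbours of `v`. -/
def inNbrs (D : Digraph V) (v : V) : Set V := {x | D.Adj x v}

/-- The out-semi-cut of `v`: all arcs with tail `v`. -/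
def outCut (D : Digraph V) (v : V) : Set D.Arc := {a | a.1.1 = v}

/-- The in-semi-cut of `v`: all arcs with head `v`. -/
def inCut (D : Digraph V) (v : V) : Set D.Arc := {a | a.1.2 = v}

/-- The weak-odd condition at a vertex `v` for an arc-coloring `φ` with `k` colors: some color
occurs an odd number of times on each nonempty semi-cut of `v` (the same color for both of them).
There is no requirement at an isolated vertex, also when `k = 0`. -/
def WeakOddAt (D : Digraph V) {k : ℕ} (φ : D.Arc → Fin k) (v : V) : Prop :=
  ((D.outCut v).Nonempty ∨ (D.inCut v).Nonempty) →
    ∃ i : Fin k,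
      ((D.outCut v).Nonempty → Odd {a ∈ D.outCut v | φ a = i}.ncard) ∧
      ((D.inCut v).Nonempty → Odd {a ∈ D.inCut v | φ a = i}.ncard)

/-- `D` is weak-odd `k`-edge colorable. -/
def WeakOddColorable (D : Digraph V) (k : ℕ) : Prop :=
  ∃ φ : D.Arc → Fin k, ∀ v, D.WeakOddAt φ v

/-- The weak-odd chromatic index: the least `k` such that `D` is weak-odd `k`-edge colorable. -/
noncomputable def weakOddIndex (D : Digraph V) : ℕ := sInf {k | D.WeakOddColorable k}

/-- The defect: the least number of vertices at which the weak-odd condition fails, over all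
colorings of the arcs with two colors. -/
noncomputable def defect (D : Digraph V) : ℕ :=
  sInf {m | ∃ φ : D.Arc → Fin 2, {v | ¬ D.WeakOddAt φ v}.ncard = m}

/-- Tournaments: no loops, and any two distinct vertices are joined by an arc in exactly one of
the two directions. -/
structure IsTournament (T : Digraph V) : Prop where
  loopless : ∀ v, ¬ T.Adj v v
  adj_xor : ∀ u v, u ≠ v → Xor (T.Adj u v) (T.Adj v u)

/-- Blow up each vertex `v` of `D` into an independent set `I v`; all arcs between `I u` and `I v`
are present exactly when `uv` is an arc of `D`. -/
def blowUp (D : Digraph V) (I : V → Type w) : Digraph (Σ v, I v) where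
  Adj x y := D.Adj x.1 y.1

/-- The blow-up of the tournament `T` into independent sets `I v` is a bad extended tournament:
`T` has more than three vertices, the blow-up has odd order, exactly one of the independent sets
is of even size, and for the vertex `z` of `T` to which it belongs, every out-neighbour of `z`
dominates every in-neighbour of `z`, and `z` has just one in-neighbour or just one
out-neighbour. -/
def IsBadBlowUp (T : Digraph V) (I : V → Type w) : Prop :=
  3 < Nat.card V ∧
  Odd (Nat.card (Σ v, I v)) ∧
  ∃ z : V, (∀ v, Even (Nat.card (I v)) ↔ v = z) ∧
    (∀ x ∈ T.outNbrs z, ∀ y ∈ T.inNbrs z, T.Adj x y) ∧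
    ((T.inNbrs z).ncard = 1 ∨ (T.outNbrs z).ncard = 1)

end Digraph

namespace Digraph

/-! ### Finite computations modulo two -/

/-! Everything is counted modulo 2. A 2-coloring is recorded by the out- and in-degree parities `p`
of its class of color 0. On a nonempty semi-cut of even size both colors have the same parity, so
`p` must be 1 there. On one of odd size exactly one color is odd; this matters only if both
semi-cuts are odd, and then the two values of `p` must agree. The vectors `p` that occur are spanned
by the edges of the split graph (an out-copy and an in-copy of each vertex, one edge per arc), so
they are the vectors with even sum on every component.

Summing `p` over the copies of each vertex reduces the blow-up to the same problem on the
tournament, with weights `m` equal to the part sizes modulo 2 (`weakOddColorable_blowUp_iff`). For a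
tournament, either the non-isolated nodes of the split graph form one component, or there is a
bridge `rq` (`IsTournament.splitConnected_or_exists_isBridge`).

With one component, the total parity is the only obstruction. A vertex whose weighted out- and
in-degree have different parities has an unconstrained node that repairs it. If no such vertex
exists, all weights are equal, and failure forces odd parts, odd order, and a source or a sink but
not both. Three colors then suffice for `T`: one arc at the source or sink gets a color of its own
(`IsTournament.weakOddColorable_three_of_source`).

With a bridge, its two nodes must also agree. The cyclic triangle is always solvable; otherwise the
conditions are unsolvable exactly for bad blow-ups. In all cases exempting one vertex leaves enough
freedom, so the defect is at most 1. -/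

theorem zmod_two_eq_or (x : ZMod 2) : x = 0 ∨ x = 1 := by
  revert x; decide

set_option synthInstance.maxSize 1024 in
set_option synthInstance.maxHeartbeats 400000 in
-- Here `o`, `i` are the degree parities and `a`, `b` those of the first color class; the other
-- class has parities `o + a` and `i + b`.
theorem exists_color_iff (P Q : Prop) (o i a b : ZMod 2) :
    ((P ∨ Q) → (((P → a = 1) ∧ (Q → b = 1)) ∨ ((P → o + a = 1) ∧ (Q → i + b = 1)))) ↔
      (P → o = 0 → a = 1) ∧ (Q → i = 0 → b = 1) ∧ (P → Q → o = 1 → i = 1 → a = b) := by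
  by_cases hP : P <;> by_cases hQ : Q <;> simp only [hP, hQ] <;> revert o i a b <;> decide

set_option synthInstance.maxSize 1024 in
set_option synthInstance.maxHeartbeats 400000 in
/-- Class sums at the two ends of a bridge of the split graph, and the correction at a vertex with
degrees of different parities. -/
theorem exists_bridge_flexible : ∀ α β π ρ : ZMod 2, ∃ a b c t : ZMod 2,
    ((β = 0 → a = α) ∧ (π = 0 → b = α) ∧ (β = 1 → π = 1 → a = b)) ∧
    ((π = 0 → c = β) ∧ (α = 0 → a = β) ∧ (π = 1 → α = 1 → c = a)) ∧
    a + b + c + a + ρ + t = 0 := by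
  decide

set_option synthInstance.maxSize 1024 in
set_option synthInstance.maxHeartbeats 400000 in
-- The excluded case is a true obstruction: `π = 0` forces `b = α` and `c = β`, so the sum would be
-- `α + β = 1`. The value `a` enters twice because it sits at both ends of the bridge.
theorem exists_bridge : ∀ α β π : ZMod 2, ¬ (α + β = 1 ∧ π = 0) → ∃ a b c : ZMod 2,
    ((β = 0 → a = α) ∧ (π = 0 → b = α) ∧ (β = 1 → π = 1 → a = b)) ∧
    ((π = 0 → c = β) ∧ (α = 0 → a = β) ∧ (π = 1 → α = 1 → c = a)) ∧
    a + b + c + a = 0 := by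
  decide

set_option synthInstance.maxSize 1024 in
set_option synthInstance.maxHeartbeats 400000 in
-- Without the conditions at the head of the bridge, `c` occurs only in the sum and absorbs it.
theorem exists_bridge_exempt : ∀ α β π ρ : ZMod 2, ∃ a b c : ZMod 2,
    ((β = 0 → a = α) ∧ (π = 0 → b = α) ∧ (β = 1 → π = 1 → a = b)) ∧
    a + b + c + a + ρ = 0 := by
  decide

set_option synthInstance.maxSize 1024 in
set_option synthInstance.maxHeartbeats 400000 in
theorem exists_triangle : ∀ α β π : ZMod 2, ∃ a b c : ZMod 2,
    ((β = 0 → a = α) ∧ (π = 0 → c = α) ∧ (β = 1 → π = 1 → a = c)) ∧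
    ((π = 0 → b = β) ∧ (α = 0 → a = β) ∧ (π = 1 → α = 1 → b = a)) ∧
    ((α = 0 → c = π) ∧ (β = 0 → b = π) ∧ (α = 1 → β = 1 → c = b)) := by
  decide

end Digraph

/-! ### Colorings as functions on pairs, and color counts modulo 2 -/

section

open scoped Classical

namespace Digraph

universe u w

variable {V : Type u}

/-- The color class counts of a coloring, given by a function on all pairs of vertices, satisfy the
weak-odd condition at `v`; counts are taken modulo `2`. -/
def OddAt [Fintype V] (D : Digraph V) {k : ℕ} (c : V → V → Fin k) (v : V) : Prop :=
  ((∃ u, D.Adj v u) ∨ (∃ u, D.Adj u v)) →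
    ∃ i : Fin k,
      ((∃ u, D.Adj v u) → (∑ u, if D.Adj v u ∧ c v u = i then (1 : ZMod 2) else 0) = 1) ∧
      ((∃ u, D.Adj u v) → (∑ u, if D.Adj u v ∧ c u v = i then (1 : ZMod 2) else 0) = 1)

theorem outCut_nonempty_iff (D : Digraph V) (v : V) :
    (D.outCut v).Nonempty ↔ ∃ u, D.Adj v u := by
  constructor
  · rintro ⟨⟨⟨a, b⟩, h⟩, rfl⟩
    exact ⟨b, h⟩
  · rintro ⟨u, h⟩
    exact ⟨⟨(v, u), h⟩, rfl⟩

theorem inCut_nonempty_iff (D : Digraph V) (v : V) :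
    (D.inCut v).Nonempty ↔ ∃ u, D.Adj u v := by
  constructor
  · rintro ⟨⟨⟨a, b⟩, h⟩, rfl⟩
    exact ⟨a, h⟩
  · rintro ⟨u, h⟩
    exact ⟨⟨(u, v), h⟩, rfl⟩

theorem odd_ncard_outCut_iff [Fintype V] (D : Digraph V) {k : ℕ} (c : V → V → Fin k)
    (v : V) (i : Fin k) :
    Odd {a ∈ D.outCut v | c a.1.1 a.1.2 = i}.ncard ↔
      (∑ u, if D.Adj v u ∧ c v u = i then (1 : ZMod 2) else 0) = 1 := by
  have : {a ∈ D.outCut v | c a.1.1 a.1.2 = i}.ncard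
      = {u | D.Adj v u ∧ c v u = i}.ncard := by
    refine Set.ncard_congr (fun a _ => a.1.2) ?_ ?_ ?_
    · rintro ⟨⟨a, b⟩, h⟩ ⟨rfl, hc⟩
      exact ⟨h, hc⟩
    · rintro ⟨⟨a, b⟩, h⟩ ⟨⟨a', b'⟩, h'⟩ ⟨rfl, _⟩ ⟨ha, _⟩ hb
      obtain rfl : a' = a := ha
      obtain rfl : b = b' := hb
      rfl
    · rintro b ⟨h, hc⟩
      exact ⟨⟨(v, b), h⟩, ⟨rfl, hc⟩, rfl⟩
  rw [this, Finset.sum_boole, ← ZMod.natCast_eq_one_iff_odd, Set.ncard_eq_toFinset_card']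
  simp

theorem odd_ncard_inCut_iff [Fintype V] (D : Digraph V) {k : ℕ} (c : V → V → Fin k)
    (v : V) (i : Fin k) :
    Odd {a ∈ D.inCut v | c a.1.1 a.1.2 = i}.ncard ↔
      (∑ u, if D.Adj u v ∧ c u v = i then (1 : ZMod 2) else 0) = 1 := by
  have : {a ∈ D.inCut v | c a.1.1 a.1.2 = i}.ncard
      = {u | D.Adj u v ∧ c u v = i}.ncard := by
    refine Set.ncard_congr (fun a _ => a.1.1) ?_ ?_ ?_
    · rintro ⟨⟨a, b⟩, h⟩ ⟨rfl, hc⟩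
      exact ⟨h, hc⟩
    · rintro ⟨⟨a, b⟩, h⟩ ⟨⟨a', b'⟩, h'⟩ ⟨rfl, _⟩ ⟨ha, _⟩ hb
      obtain rfl : b' = b := ha
      obtain rfl : a = a' := hb
      rfl
    · rintro b ⟨h, hc⟩
      exact ⟨⟨(b, v), h⟩, ⟨rfl, hc⟩, rfl⟩
  rw [this, Finset.sum_boole, ← ZMod.natCast_eq_one_iff_odd, Set.ncard_eq_toFinset_card']
  simp

theorem weakOddAt_iff_oddAt [Fintype V] (D : Digraph V) {k : ℕ} (c : V → V → Fin k) (v : V) :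
    D.WeakOddAt (fun a => c a.1.1 a.1.2) v ↔ D.OddAt c v := by
  simp only [WeakOddAt, OddAt, outCut_nonempty_iff, inCut_nonempty_iff, odd_ncard_outCut_iff,
    odd_ncard_inCut_iff]

/-- Non-arcs receive an arbitrary color, which never enters a count; writing `k + 1` guarantees that
a color exists. -/
theorem exists_pairColoring (D : Digraph V) {k : ℕ} (φ : D.Arc → Fin (k + 1)) :
    ∃ c : V → V → Fin (k + 1), φ = fun a => c a.1.1 a.1.2 := by
  refine ⟨fun u v => if h : D.Adj u v then φ ⟨(u, v), h⟩ else 0, ?_⟩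
  funext a
  simp only
  split_ifs with h
  · rfl
  · exact absurd a.2 h

theorem weakOddColorable_succ_iff [Fintype V] (D : Digraph V) (k : ℕ) :
    D.WeakOddColorable (k + 1) ↔ ∃ c : V → V → Fin (k + 1), ∀ v, D.OddAt c v := by
  constructor
  · rintro ⟨φ, h⟩
    obtain ⟨c, rfl⟩ := D.exists_pairColoring φ
    exact ⟨c, fun v => (D.weakOddAt_iff_oddAt c v).1 (h v)⟩
  · rintro ⟨c, h⟩
    exact ⟨_, fun v => (D.weakOddAt_iff_oddAt c v).2 (h v)⟩

theorem WeakOddColorable.mono {D : Digraph V} {k l : ℕ} (hkl : k ≤ l)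
    (h : D.WeakOddColorable k) : D.WeakOddColorable l := by
  obtain ⟨φ, h⟩ := h
  refine ⟨fun a => Fin.castLE hkl (φ a), fun v hv => ?_⟩
  obtain ⟨i, hi⟩ := h v hv
  refine ⟨Fin.castLE hkl i, ?_⟩
  simpa [Fin.castLE_inj] using hi

/-- Reversing all arcs. -/
def rev (D : Digraph V) : Digraph V where
  Adj u v := D.Adj v u

theorem weakOddColorable_of_rev [Fintype V] {D : Digraph V} {k : ℕ}
    (h : D.rev.WeakOddColorable (k + 1)) :
    D.WeakOddColorable (k + 1) := by
  rw [weakOddColorable_succ_iff] at h ⊢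
  obtain ⟨c, h⟩ := h
  refine ⟨fun u v => c v u, fun v hv => ?_⟩
  obtain ⟨i, h1, h2⟩ := h v hv.symm
  exact ⟨i, h2, h1⟩

theorem defect_eq_zero_iff [Finite V] (D : Digraph V) : D.defect = 0 ↔ D.WeakOddColorable 2 := by
  rw [defect, Nat.sInf_eq_zero]
  constructor
  · rintro (⟨φ, h⟩ | h)
    · rw [Set.ncard_eq_zero, Set.eq_empty_iff_forall_notMem] at h
      exact ⟨φ, fun v => not_not.1 (h v)⟩
    -- The infimum of an empty set would also be zero; a constant coloring rules this out.
    · exact absurd h (Set.nonempty_iff_ne_empty.1 ⟨_, fun _ => 0, rfl⟩)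
  · rintro ⟨φ, h⟩
    exact Or.inl ⟨φ, by simp [h]⟩

theorem defect_le_one [Finite V] {D : Digraph V} (φ : D.Arc → Fin 2) (v₀ : V)
    (h : ∀ v, v ≠ v₀ → D.WeakOddAt φ v) : D.defect ≤ 1 := by
  have hle : D.defect ≤ {v | ¬ D.WeakOddAt φ v}.ncard := Nat.sInf_le ⟨φ, rfl⟩
  refine hle.trans ?_
  rw [← Set.ncard_singleton v₀]
  exact Set.ncard_le_ncard fun v hv => by_contra fun hne => hv (h v hne)

theorem IsTournament.rev {T : Digraph V} (hT : T.IsTournament) : T.rev.IsTournament :=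
  ⟨hT.loopless, fun u v huv => (hT.adj_xor v u huv.symm)⟩

end Digraph

/-! ### Parity vectors of color classes -/

namespace Digraph

universe u w

variable {V : Type u}

/-- The indicator of a node of the split graph, whose nodes are an out-copy `Sum.inl v` and an
in-copy `Sum.inr v` of each vertex `v`. -/
noncomputable def nodeVec (x : V ⊕ V) : V ⊕ V → ZMod 2 := fun y => if y = x then 1 else 0

/-- The indicator of the tail of an arc on the left copy of the vertices, plus the indicator of
its head on the right copy. -/
noncomputable def arcVec (u v : V) : V ⊕ V → ZMod 2 := nodeVec (Sum.inl u) + nodeVec (Sum.inr v)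

/-- The parity vectors of arc sets: all out- and in-degrees modulo `2`. -/
noncomputable def degSpace (D : Digraph V) : Submodule (ZMod 2) (V ⊕ V → ZMod 2) :=
  Submodule.span (ZMod 2) {p | ∃ u v, D.Adj u v ∧ p = arcVec u v}

theorem arcVec_mem {D : Digraph V} {u v : V} (h : D.Adj u v) : arcVec u v ∈ D.degSpace :=
  Submodule.subset_span ⟨u, v, h, rfl⟩

/-- Over the field with two elements, the coefficients of a combination of arc vectors are the
indicator `f` of an arc set. -/
theorem mem_degSpace_iff [Fintype V] {D : Digraph V} {p : V ⊕ V → ZMod 2} :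
    p ∈ D.degSpace ↔ ∃ f : V → V → ZMod 2, (∀ u v, ¬ D.Adj u v → f u v = 0) ∧
      (∀ u, p (Sum.inl u) = ∑ v, f u v) ∧ (∀ v, p (Sum.inr v) = ∑ u, f u v) := by
  constructor
  · intro h
    induction h using Submodule.span_induction with
    | mem p hp =>
      obtain ⟨a, b, hab, rfl⟩ := hp
      refine ⟨fun u v => if u = a ∧ v = b then 1 else 0, ?_, ?_, ?_⟩
      · rintro u v h
        refine if_neg ?_
        rintro ⟨rfl, rfl⟩
        exact h hab
      · intro u
        by_cases hu : u = a <;> simp [arcVec, nodeVec, hu]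
      · intro v
        by_cases hv : v = b <;> simp [arcVec, nodeVec, hv]
    | zero => exact ⟨0, by simp, by simp, by simp⟩
    | add p q _ _ hp hq =>
      obtain ⟨f, f1, f2, f3⟩ := hp
      obtain ⟨g, g1, g2, g3⟩ := hq
      refine ⟨f + g, fun u v h => by simp [f1 u v h, g1 u v h], fun u => ?_, fun v => ?_⟩
      · simp [f2, g2, Finset.sum_add_distrib]
      · simp [f3, g3, Finset.sum_add_distrib]
    | smul c p _ hp =>
      obtain ⟨f, f1, f2, f3⟩ := hp
      refine ⟨c • f, fun u v h => by simp [f1 u v h], fun u => ?_, fun v => ?_⟩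
      · simp [f2, Finset.mul_sum]
      · simp [f3, Finset.mul_sum]
  · rintro ⟨f, f1, f2, f3⟩
    have : p = ∑ u, ∑ v, f u v • arcVec u v := by
      funext x
      rcases x with x | x
      · simp [arcVec, nodeVec, f2]
      · simp [arcVec, nodeVec, f3]
    rw [this]
    refine Submodule.sum_mem _ fun u _ => Submodule.sum_mem _ fun v _ => ?_
    by_cases h : D.Adj u v
    · exact Submodule.smul_mem _ _ (arcVec_mem h)
    · simp [f1 u v h]

theorem exists_blowUp_adj_iff (D : Digraph V) (I : V → Type w) [∀ v, Nonempty (I v)]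
    (x : Σ v, I v) :
    (∃ y, (D.blowUp I).Adj x y) ↔ ∃ v, D.Adj x.1 v :=
  ⟨fun ⟨y, h⟩ => ⟨y.1, h⟩, fun ⟨v, h⟩ => ⟨⟨v, Classical.arbitrary _⟩, h⟩⟩

theorem exists_adj_blowUp_iff (D : Digraph V) (I : V → Type w) [∀ v, Nonempty (I v)]
    (x : Σ v, I v) :
    (∃ y, (D.blowUp I).Adj y x) ↔ ∃ v, D.Adj v x.1 :=
  ⟨fun ⟨y, h⟩ => ⟨y.1, h⟩, fun ⟨v, h⟩ => ⟨⟨v, Classical.arbitrary _⟩, h⟩⟩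

variable [Fintype V]

/-- The total weight of the out-neighbours. -/
noncomputable def wOut (D : Digraph V) (m : V → ZMod 2) (v : V) : ZMod 2 :=
  ∑ u, if D.Adj v u then m u else 0

/-- The total weight of the in-neighbours. -/
noncomputable def wIn (D : Digraph V) (m : V → ZMod 2) (v : V) : ZMod 2 :=
  ∑ u, if D.Adj u v then m u else 0

/-- The condition on the degree parities `p` that a color class has at `v`, in the quotient of a
blow-up of `D` by sets whose sizes have the parities `m`. -/
def ParityOk (D : Digraph V) (m : V → ZMod 2) (p : V ⊕ V → ZMod 2) (v : V) : Prop :=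
  ((∃ u, D.Adj v u) → D.wOut m v = 0 → p (Sum.inl v) = m v) ∧
  ((∃ u, D.Adj u v) → D.wIn m v = 0 → p (Sum.inr v) = m v) ∧
  ((∃ u, D.Adj v u) → (∃ u, D.Adj u v) → D.wOut m v = 1 → D.wIn m v = 1 →
    p (Sum.inl v) = p (Sum.inr v))

theorem oddAt_iff_parityOk (D : Digraph V) (c : V → V → Fin 2) (f : V → V → ZMod 2)
    (hf : ∀ u v, f u v = if D.Adj u v ∧ c u v = 0 then 1 else 0) (p : V ⊕ V → ZMod 2)
    (hl : ∀ u, p (Sum.inl u) = ∑ v, f u v) (hr : ∀ v, p (Sum.inr v) = ∑ u, f u v) (v : V) :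
    D.OddAt c v ↔ D.ParityOk 1 p v := by
  have key : ∀ u v, (if D.Adj u v ∧ c u v = 1 then (1 : ZMod 2) else 0)
      = (if D.Adj u v then 1 else 0) + f u v := by
    intro u v
    rw [hf]
    have : c u v = 0 ∨ c u v = 1 := by
      generalize c u v = x
      revert x; decide
    by_cases h : D.Adj u v <;> rcases this with h' | h' <;> simp [h, h']
    decide
  simp only [OddAt, ParityOk, Fin.exists_fin_two, key, Finset.sum_add_distrib, ← hf, ← hl, ← hr,
    Pi.one_apply]
  exact exists_color_iff _ _ (D.wOut 1 v) (D.wIn 1 v) _ _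

theorem exists_mem_degSpace (D : Digraph V) (c : V → V → Fin 2) :
    ∃ p ∈ D.degSpace, ∀ v, D.OddAt c v ↔ D.ParityOk 1 p v := by
  let f : V → V → ZMod 2 := fun u v => if D.Adj u v ∧ c u v = 0 then 1 else 0
  refine ⟨Sum.elim (fun u => ∑ v, f u v) (fun v => ∑ u, f u v), ?_, ?_⟩
  · exact mem_degSpace_iff.2 ⟨f, fun u v h => by simp [f, h], fun _ => rfl, fun _ => rfl⟩
  · exact D.oddAt_iff_parityOk c f (fun _ _ => rfl) _ (fun _ => rfl) (fun _ => rfl)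

theorem exists_oddAt_iff (D : Digraph V) {p : V ⊕ V → ZMod 2} (hp : p ∈ D.degSpace) :
    ∃ c : V → V → Fin 2, ∀ v, D.OddAt c v ↔ D.ParityOk 1 p v := by
  obtain ⟨f, f1, f2, f3⟩ := mem_degSpace_iff.1 hp
  refine ⟨fun u v => if f u v = 1 then 0 else 1, D.oddAt_iff_parityOk _ f ?_ p f2 f3⟩
  intro u v
  by_cases h : D.Adj u v
  · rcases zmod_two_eq_or (f u v) with h' | h' <;> simp [h, h']
  · simp [h, f1 u v h]

theorem weakOddColorable_two_iff (D : Digraph V) :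
    D.WeakOddColorable 2 ↔ ∃ p ∈ D.degSpace, ∀ v, D.ParityOk 1 p v := by
  rw [weakOddColorable_succ_iff]
  constructor
  · rintro ⟨c, h⟩
    obtain ⟨p, hp, h'⟩ := D.exists_mem_degSpace c
    exact ⟨p, hp, fun v => (h' v).1 (h v)⟩
  · rintro ⟨p, hp, h⟩
    obtain ⟨c, h'⟩ := D.exists_oddAt_iff hp
    exact ⟨c, fun v => (h' v).2 (h v)⟩

theorem defect_le_one_of_parityOk {D : Digraph V} {p : V ⊕ V → ZMod 2} (hp : p ∈ D.degSpace)
    (v₀ : V) (h : ∀ v, v ≠ v₀ → D.ParityOk 1 p v) : D.defect ≤ 1 := by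
  obtain ⟨c, h'⟩ := D.exists_oddAt_iff hp
  exact defect_le_one _ v₀ fun v hv => (D.weakOddAt_iff_oddAt c v).2 ((h' v).2 (h v hv))

theorem eq_zero_of_mem_degSpace {D : Digraph V} {p : V ⊕ V → ZMod 2} (hp : p ∈ D.degSpace) :
    (∀ v, (¬ ∃ u, D.Adj v u) → p (Sum.inl v) = 0) ∧
      (∀ v, (¬ ∃ u, D.Adj u v) → p (Sum.inr v) = 0) := by
  obtain ⟨f, f1, f2, f3⟩ := mem_degSpace_iff.1 hp
  refine ⟨fun v hv => ?_, fun v hv => ?_⟩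
  · rw [f2]
    exact Finset.sum_eq_zero fun u _ => f1 _ _ fun h => hv ⟨u, h⟩
  · rw [f3]
    exact Finset.sum_eq_zero fun u _ => f1 _ _ fun h => hv ⟨u, h⟩

/-! ### Reduction of a blow-up to its quotient -/

section BlowUp

variable (D : Digraph V) (I : V → Type w) [∀ v, Fintype (I v)]

theorem wOut_blowUp (x : Σ v, I v) :
    (D.blowUp I).wOut 1 x = D.wOut (fun v => (Fintype.card (I v) : ZMod 2)) x.1 := by
  rw [wOut, wOut, Fintype.sum_sigma]
  exact Finset.sum_congr rfl fun v _ => by by_cases h : D.Adj x.1 v <;> simp [blowUp, h]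

theorem wIn_blowUp (x : Σ v, I v) :
    (D.blowUp I).wIn 1 x = D.wIn (fun v => (Fintype.card (I v) : ZMod 2)) x.1 := by
  rw [wIn, wIn, Fintype.sum_sigma]
  exact Finset.sum_congr rfl fun v _ => by by_cases h : D.Adj v x.1 <;> simp [blowUp, h]

/-- Summing over the copies of `v` preserves the conditions: a forced value 1 at each copy adds up
to the part size, and equalities add up. -/
theorem exists_parityOk_quotient [∀ v, Nonempty (I v)] {p : (Σ v, I v) ⊕ (Σ v, I v) → ZMod 2}
    (hp : p ∈ (D.blowUp I).degSpace) (h : ∀ x, (D.blowUp I).ParityOk 1 p x) :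
    ∃ q ∈ D.degSpace, ∀ v, D.ParityOk (fun v => (Fintype.card (I v) : ZMod 2)) q v := by
  obtain ⟨f, f1, f2, f3⟩ := mem_degSpace_iff.1 hp
  refine ⟨Sum.elim (fun v => ∑ i, p (Sum.inl ⟨v, i⟩)) (fun v => ∑ i, p (Sum.inr ⟨v, i⟩)),
    mem_degSpace_iff.2 ⟨fun u v => ∑ i : I u, ∑ j : I v, f ⟨u, i⟩ ⟨v, j⟩, ?_, ?_, ?_⟩, ?_⟩
  · intro u v huv
    exact Finset.sum_eq_zero fun i _ => Finset.sum_eq_zero fun j _ => f1 _ _ huv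
  · intro u
    simp only [Sum.elim_inl, f2, Fintype.sum_sigma]
    exact Finset.sum_comm
  · intro v
    simp only [Sum.elim_inr, f3, Fintype.sum_sigma]
    rw [Finset.sum_comm]
    exact Finset.sum_congr rfl fun u _ => Finset.sum_comm
  · intro v
    simp only [ParityOk, wOut_blowUp, wIn_blowUp, exists_blowUp_adj_iff, exists_adj_blowUp_iff,
      Pi.one_apply] at h
    refine ⟨fun h1 h2 => ?_, fun h1 h2 => ?_, fun h1 h2 h3 h4 => ?_⟩
    · simp only [Sum.elim_inl]
      rw [Finset.sum_congr rfl fun i _ => (h ⟨v, i⟩).1 h1 h2]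
      simp
    · simp only [Sum.elim_inr]
      rw [Finset.sum_congr rfl fun i _ => (h ⟨v, i⟩).2.1 h1 h2]
      simp
    · exact Finset.sum_congr rfl fun i _ => (h ⟨v, i⟩).2.2 h1 h2 h3 h4

end BlowUp

end Digraph

/-! ### Links in the split graph, and lifting from the quotient to the blow-up -/

namespace Digraph

universe u w

variable {V : Type u}

/-- Two nodes of the split graph are linked if the sum of their indicators is a parity vector. -/
def Link (D : Digraph V) (x y : V ⊕ V) : Prop :=
  nodeVec x + nodeVec y ∈ D.degSpace

theorem vec_add_self {α : Type*} (p : α → ZMod 2) : p + p = 0 :=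
  funext fun _ => CharTwo.add_self_eq_zero _

theorem Link.refl (D : Digraph V) (x : V ⊕ V) : D.Link x x := by
  unfold Link
  rw [vec_add_self]
  exact Submodule.zero_mem _

theorem Link.symm {D : Digraph V} {x y : V ⊕ V} (h : D.Link x y) : D.Link y x := by
  unfold Link at h ⊢
  rwa [add_comm]

theorem Link.trans {D : Digraph V} {x y z : V ⊕ V} (h : D.Link x y) (h' : D.Link y z) :
    D.Link x z := by
  unfold Link at h h' ⊢
  have := Submodule.add_mem _ h h'
  rwa [add_assoc, ← add_assoc (nodeVec y), vec_add_self, zero_add] at this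

theorem link_of_adj {D : Digraph V} {u v : V} (h : D.Adj u v) : D.Link (Sum.inl u) (Sum.inr v) :=
  arcVec_mem h

/-- Moving each unit of `p` from `x` to a linked node `b x` changes `p` only by an element of the
space. -/
theorem mem_degSpace_of_link [Fintype V] {D : Digraph V} {p : V ⊕ V → ZMod 2}
    (b : V ⊕ V → V ⊕ V) (hb : ∀ x, p x ≠ 0 → D.Link x (b x))
    (h : ∑ x, p x • nodeVec (b x) ∈ D.degSpace) : p ∈ D.degSpace := by
  have h1 : p = ∑ x, p x • nodeVec x := by
    funext y
    simp [nodeVec]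
  have h2 : ∑ x, p x • (nodeVec x + nodeVec (b x)) ∈ D.degSpace := by
    refine Submodule.sum_mem _ fun x _ => ?_
    by_cases hx : p x = 0
    · simp [hx]
    · exact Submodule.smul_mem _ _ (hb x hx)
  simp only [smul_add, Finset.sum_add_distrib] at h2
  rw [← h1] at h2
  exact (Submodule.add_mem_iff_left _ h).1 h2

theorem mem_degSpace_of_sum_eq_zero [Fintype V] {D : Digraph V} {p : V ⊕ V → ZMod 2}
    (x₀ : V ⊕ V) (hb : ∀ x, p x ≠ 0 → D.Link x x₀) (h : ∑ x, p x = 0) : p ∈ D.degSpace := by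
  refine mem_degSpace_of_link (fun _ => x₀) hb ?_
  rw [← Finset.sum_smul, h, zero_smul]
  exact Submodule.zero_mem _

section BlowUp

variable [Fintype V] (D : Digraph V) (I : V → Type w)

/-- Transport of a vector on the split graph along a choice of representatives. -/
noncomputable def repVec (e : ∀ v, I v) (q : V ⊕ V → ZMod 2) :
    (Σ v, I v) ⊕ (Σ v, I v) → ZMod 2 :=
  ∑ v, q (Sum.inl v) • nodeVec (Sum.inl ⟨v, e v⟩) +
    ∑ v, q (Sum.inr v) • nodeVec (Sum.inr ⟨v, e v⟩)

theorem repVec_mem (e : ∀ v, I v) {q : V ⊕ V → ZMod 2} (hq : q ∈ D.degSpace) :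
    repVec I e q ∈ (D.blowUp I).degSpace := by
  induction hq using Submodule.span_induction with
  | mem q hq =>
    obtain ⟨a, b, hab, rfl⟩ := hq
    have : repVec I e (arcVec a b) = arcVec ⟨a, e a⟩ ⟨b, e b⟩ := by
      simp [repVec, arcVec, nodeVec]
    rw [this]
    exact arcVec_mem hab
  | zero => simp [repVec]
  | add p q _ _ hp hq =>
    have : repVec I e (p + q) = repVec I e p + repVec I e q := by
      simp only [repVec, Pi.add_apply, add_smul, Finset.sum_add_distrib]
      abel
    rw [this]
    exact Submodule.add_mem _ hp hq
  | smul c p _ hp =>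
    have : repVec I e (c • p) = c • repVec I e p := by
      simp only [repVec, Pi.smul_apply, smul_assoc, smul_add, Finset.smul_sum]
    rw [this]
    exact Submodule.smul_mem _ _ hp

variable [∀ v, Fintype (I v)]

/-- Copies of a non-isolated node share a neighbour, so all mass of `p` can be moved to the
representatives, where it becomes the transport of `q`. -/
theorem mem_degSpace_blowUp (e : ∀ v, I v) {q : V ⊕ V → ZMod 2} (hq : q ∈ D.degSpace)
    {p : (Σ v, I v) ⊕ (Σ v, I v) → ZMod 2}
    (hl : ∀ v, q (Sum.inl v) = ∑ i, p (Sum.inl ⟨v, i⟩))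
    (hr : ∀ v, q (Sum.inr v) = ∑ i, p (Sum.inr ⟨v, i⟩))
    (hl' : ∀ x, p (Sum.inl x) ≠ 0 → ∃ u, D.Adj x.1 u)
    (hr' : ∀ x, p (Sum.inr x) ≠ 0 → ∃ u, D.Adj u x.1) :
    p ∈ (D.blowUp I).degSpace := by
  refine mem_degSpace_of_link
    (Sum.map (fun x => ⟨x.1, e x.1⟩) (fun x => ⟨x.1, e x.1⟩)) ?_ ?_
  · rintro (x | x) hx
    · obtain ⟨u, hu⟩ := hl' x hx
      have h1 : (D.blowUp I).Adj x ⟨u, e u⟩ := hu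
      have h2 : (D.blowUp I).Adj ⟨x.1, e x.1⟩ ⟨u, e u⟩ := hu
      exact (link_of_adj h1).trans (link_of_adj h2).symm
    · obtain ⟨u, hu⟩ := hr' x hx
      have h1 : (D.blowUp I).Adj ⟨u, e u⟩ x := hu
      have h2 : (D.blowUp I).Adj ⟨u, e u⟩ ⟨x.1, e x.1⟩ := hu
      exact (link_of_adj h1).symm.trans (link_of_adj h2)
  · have h := repVec_mem D I e hq
    simpa only [repVec, Fintype.sum_sum_type, Fintype.sum_sigma, Sum.map_inl, Sum.map_inr, hl, hr,
      Finset.sum_smul] using h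

variable [∀ v, Nonempty (I v)]

/-- The parity conditions of the quotient lift to the blow-up; where the condition fails in the
quotient, it can be made to hold at all but one of the copies. -/
theorem exists_parityOk_blowUp (e : ∀ v, I v) {q : V ⊕ V → ZMod 2} (hq : q ∈ D.degSpace) :
    ∃ p ∈ (D.blowUp I).degSpace, ∀ x : Σ v, I v,
      (x = ⟨x.1, e x.1⟩ → D.ParityOk (fun v => (Fintype.card (I v) : ZMod 2)) q x.1) →
        (D.blowUp I).ParityOk 1 p x := by
  set m : V → ZMod 2 := fun v => (Fintype.card (I v) : ZMod 2) with hm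
  obtain ⟨hq1, hq2⟩ := eq_zero_of_mem_degSpace hq
  -- `a` and `b` are the values forced at every copy by a semi-cut of even size. The representative
  -- alone carries the correction that makes the copies sum to `q`.
  let a : V → ZMod 2 := fun v => if (∃ u, D.Adj v u) ∧ D.wOut m v = 0 then 1 else 0
  let b : V → ZMod 2 := fun v => if (∃ u, D.Adj u v) ∧ D.wIn m v = 0 then 1 else 0
  let p : (Σ v, I v) ⊕ (Σ v, I v) → ZMod 2 := Sum.elim
    (fun x => a x.1 + if x.2 = e x.1 then q (Sum.inl x.1) + m x.1 * a x.1 else 0)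
    (fun x => b x.1 + if x.2 = e x.1 then q (Sum.inr x.1) + m x.1 * b x.1 else 0)
  have cancel : ∀ y z : ZMod 2, y + (z + y) = z := by decide +revert
  refine ⟨p, mem_degSpace_blowUp D I e hq ?_ ?_ ?_ ?_, ?_⟩
  · intro v
    simp only [p, Sum.elim_inl, Finset.sum_add_distrib, Finset.sum_const,
      Finset.card_univ, nsmul_eq_mul, Finset.sum_ite_eq', Finset.mem_univ, if_true]
    exact (cancel _ _).symm
  · intro v
    simp only [p, Sum.elim_inr, Finset.sum_add_distrib, Finset.sum_const,
      Finset.card_univ, nsmul_eq_mul, Finset.sum_ite_eq', Finset.mem_univ, if_true]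
    exact (cancel _ _).symm
  · intro x hx
    by_contra h
    simp [p, a, h, hq1 _ h] at hx
  · intro x hx
    by_contra h
    simp [p, b, h, hq2 _ h] at hx
  · intro x hx
    simp only [ParityOk, wOut_blowUp, wIn_blowUp, exists_blowUp_adj_iff, exists_adj_blowUp_iff,
      Pi.one_apply] at hx ⊢
    rw [← hm]
    have hx' : x.2 = e x.1 → x = ⟨x.1, e x.1⟩ := fun h => Sigma.ext rfl (heq_of_eq h)
    refine ⟨fun h1 h2 => ?_, fun h1 h2 => ?_, fun h1 h2 h3 h4 => ?_⟩
    · have : a x.1 = 1 := if_pos ⟨h1, h2⟩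
      simp only [p, Sum.elim_inl, this]
      split_ifs with h
      · rw [(hx (hx' h)).1 h1 h2, mul_one, CharTwo.add_self_eq_zero, add_zero]
      · rw [add_zero]
    · have : b x.1 = 1 := if_pos ⟨h1, h2⟩
      simp only [p, Sum.elim_inr, this]
      split_ifs with h
      · rw [(hx (hx' h)).2.1 h1 h2, mul_one, CharTwo.add_self_eq_zero, add_zero]
      · rw [add_zero]
    · have ha : a x.1 = 0 := by simp [a, h3]
      have hb : b x.1 = 0 := by simp [b, h4]
      simp only [p, Sum.elim_inl, Sum.elim_inr, ha, hb]
      split_ifs with h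
      · rw [(hx (hx' h)).2.2 h1 h2 h3 h4]
      · rfl

theorem weakOddColorable_blowUp_iff :
    (D.blowUp I).WeakOddColorable 2 ↔
      ∃ q ∈ D.degSpace, ∀ v, D.ParityOk (fun v => (Fintype.card (I v) : ZMod 2)) q v := by
  rw [weakOddColorable_two_iff]
  constructor
  · rintro ⟨p, hp, h⟩
    exact D.exists_parityOk_quotient I hp h
  · rintro ⟨q, hq, h⟩
    obtain ⟨p, hp, h'⟩ := D.exists_parityOk_blowUp I (fun _ => Classical.arbitrary _) hq
    exact ⟨p, hp, fun x => h' x fun _ => h x.1⟩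

theorem defect_blowUp_le_one {q : V ⊕ V → ZMod 2} (hq : q ∈ D.degSpace) (v₀ : V)
    (h : ∀ v, v ≠ v₀ → D.ParityOk (fun v => (Fintype.card (I v) : ZMod 2)) q v) :
    (D.blowUp I).defect ≤ 1 := by
  let e : ∀ v, I v := fun _ => Classical.arbitrary _
  obtain ⟨p, hp, h'⟩ := D.exists_parityOk_blowUp I e hq
  refine defect_le_one_of_parityOk hp ⟨v₀, e v₀⟩ fun x hx => h' x fun hx' => h _ ?_
  rintro rfl
  exact hx hx'

/-- If all parts have odd size, the blow-up behaves like the quotient. -/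
theorem weakOddColorable_blowUp_iff_of_odd (hI : ∀ v, Odd (Fintype.card (I v))) :
    (D.blowUp I).WeakOddColorable 2 ↔ D.WeakOddColorable 2 := by
  have : (fun v => (Fintype.card (I v) : ZMod 2)) = 1 :=
    funext fun v => ZMod.natCast_eq_one_iff_odd.2 (hI v)
  rw [weakOddColorable_blowUp_iff, weakOddColorable_two_iff, this]

end BlowUp

end Digraph

/-! ### Components of the split graph of a tournament, and the connected case -/

namespace Digraph

universe u w

variable {V : Type u}

/-- The non-isolated nodes of the split graph. -/
def Active (D : Digraph V) : V ⊕ V → Prop :=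
  Sum.elim (fun v => ∃ u, D.Adj v u) (fun v => ∃ u, D.Adj u v)

/-- The non-isolated nodes of the split graph form one component. -/
def SplitConnected (D : Digraph V) : Prop :=
  ∀ u v u' v', D.Adj u v → D.Adj u' v' → D.Link (Sum.inl u) (Sum.inl u')

theorem SplitConnected.link {D : Digraph V} (hD : D.SplitConnected) {x y : V ⊕ V}
    (hx : D.Active x) (hy : D.Active y) : D.Link x y := by
  have key : ∀ z, D.Active z → ∃ u v, D.Adj u v ∧ D.Link z (Sum.inl u) := by
    rintro (z | z) ⟨u, hu⟩
    · exact ⟨z, u, hu, Link.refl _ _⟩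
    · exact ⟨u, z, hu, (link_of_adj hu).symm⟩
  obtain ⟨u, v, h, h'⟩ := key x hx
  obtain ⟨u', v', k, k'⟩ := key y hy
  exact (h'.trans (hD u v u' v' h k)).trans k'.symm

/-- An arc `rq` such that `q` dominates all other vertices, which in turn dominate `r`; such an
arc is a component of the split graph. -/
structure IsBridge (T : Digraph V) (r q : V) : Prop where
  adj : T.Adj r q
  exists_other : ∃ p, p ≠ r ∧ p ≠ q
  adj_left : ∀ p, p ≠ r → p ≠ q → T.Adj q p
  adj_right : ∀ p, p ≠ r → p ≠ q → T.Adj p r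

theorem IsTournament.adj_or {T : Digraph V} (hT : T.IsTournament) {u v : V} (h : u ≠ v) :
    T.Adj u v ∨ T.Adj v u := (hT.adj_xor u v h).or

theorem IsTournament.asymm {T : Digraph V} (hT : T.IsTournament) {u v : V} (h : T.Adj u v) :
    ¬ T.Adj v u := by
  have hne : u ≠ v := by
    rintro rfl
    exact hT.loopless _ h
  rcases hT.adj_xor u v hne with h' | h'
  · exact h'.2
  · exact absurd h h'.2

theorem IsTournament.ne {T : Digraph V} (hT : T.IsTournament) {u v : V} (h : T.Adj u v) :
    u ≠ v := by
  rintro rfl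
  exact hT.loopless _ h

/-- `X` and `Y` mark the out- and in-nodes in a union of components. The arc between two vertices
respects the marks, so at most one vertex lies in `X` only, at most one in `Y` only, and the classes
"both" and "neither" are not both inhabited. An arc on the side opposite to the inhabited class must
join the two exceptional vertices. -/
theorem IsTournament.exists_isBridge_of_split {T : Digraph V} (hT : T.IsTournament)
    (X Y : V → Prop) (hXY : ∀ a b, T.Adj a b → (X a ↔ Y b)) {u v x y : V} (huv : T.Adj u v)
    (hu : X u) (hxy : T.Adj x y) (hx : ¬ X x) : ∃ r q, T.IsBridge r q := by
  have hv : Y v := (hXY _ _ huv).1 hu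
  have hy : ¬ Y y := fun h => hx ((hXY _ _ hxy).2 h)
  have hQ : ∀ a b, X a → ¬ Y a → X b → ¬ Y b → a = b := by
    intro a b ha ha' hb hb'
    by_contra hab
    rcases hT.adj_or hab with h | h
    · exact hb' ((hXY _ _ h).1 ha)
    · exact ha' ((hXY _ _ h).1 hb)
  have hR : ∀ a b, ¬ X a → Y a → ¬ X b → Y b → a = b := by
    intro a b ha ha' hb hb'
    by_contra hab
    rcases hT.adj_or hab with h | h
    · exact ha ((hXY _ _ h).2 hb')
    · exact hb ((hXY _ _ h).2 ha')
  have hPS : ∀ a b, X a → Y a → ¬ X b → ¬ Y b → False := by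
    intro a b ha ha' hb hb'
    have hab : a ≠ b := by
      rintro rfl
      exact hb ha
    rcases hT.adj_or hab with h | h
    · exact hb' ((hXY _ _ h).1 ha)
    · exact hb ((hXY _ _ h).2 ha')
  by_cases hP : ∃ a, X a ∧ Y a
  · obtain ⟨a, ha, ha'⟩ := hP
    have hS : ∀ b, X b ∨ Y b := fun b => by
      by_contra h
      rw [not_or] at h
      exact hPS a b ha ha' h.1 h.2
    have hx' : Y x := (hS x).resolve_left hx
    have hy' : X y := (hS y).resolve_right hy
    refine ⟨x, y, hxy, ⟨a, ?_, ?_⟩, fun p hpx hpy => ?_, fun p hpx hpy => ?_⟩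
    · rintro rfl; exact hx ha
    · rintro rfl; exact hy ha'
    · refine (hT.adj_or hpy).resolve_left fun h => hpx ?_
      have h1 : ¬ X p := fun h1 => hy ((hXY _ _ h).1 h1)
      exact hR _ _ h1 ((hS p).resolve_left h1) hx hx'
    · refine (hT.adj_or hpx).resolve_right fun h => hpy ?_
      have h1 : ¬ Y p := fun h1 => hx ((hXY _ _ h).2 h1)
      exact hQ _ _ ((hS p).resolve_right h1) h1 hy' hy
  · have hP' : ∀ a, X a → ¬ Y a := fun a h h' => hP ⟨a, h, h'⟩
    have hu' : ¬ Y u := hP' u hu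
    have hv' : ¬ X v := fun h => hP' v h hv
    -- If every vertex had a mark, `x = v` and `y = u`, and the two arcs would be opposite.
    have hS : ∃ b, ¬ X b ∧ ¬ Y b := by
      by_contra hS
      have hS' : ∀ b, X b ∨ Y b := fun b => by
        by_contra h
        exact hS ⟨b, not_or.1 h⟩
      obtain rfl := hR v x hv' hv hx ((hS' x).resolve_left hx)
      obtain rfl := hQ u y hu hu' ((hS' y).resolve_right hy) hy
      exact hT.asymm huv hxy
    obtain ⟨b, hb, hb'⟩ := hS
    refine ⟨u, v, huv, ⟨b, ?_, ?_⟩, fun p hpu hpv => ?_, fun p hpu hpv => ?_⟩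
    · rintro rfl; exact hb hu
    · rintro rfl; exact hb' hv
    · have h2 : ¬ Y p := fun h2 => hpv (hR _ _ (fun h1 => hP' p h1 h2) h2 hv' hv)
      exact (hT.adj_or hpv).resolve_left fun h =>
        hpu (hQ _ _ ((hXY _ _ h).2 hv) h2 hu hu')
    · have h1 : ¬ X p := fun h1 => hpu (hQ _ _ h1 (hP' p h1) hu hu')
      exact (hT.adj_or hpu).resolve_right fun h => hpv (hR _ _ h1 ((hXY _ _ h).1 hu) hv' hv)

theorem IsTournament.splitConnected_or_exists_isBridge {T : Digraph V} (hT : T.IsTournament) :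
    T.SplitConnected ∨ ∃ r q, T.IsBridge r q := by
  by_cases h : T.SplitConnected
  · exact Or.inl h
  · right
    simp only [SplitConnected, not_forall] at h
    obtain ⟨u, v, u', v', huv, huv', hl⟩ := h
    refine hT.exists_isBridge_of_split (fun a => T.Link (Sum.inl u) (Sum.inl a))
      (fun a => T.Link (Sum.inl u) (Sum.inr a)) ?_ huv (Link.refl _ _) huv' hl
    intro a b hab
    exact ⟨fun h => h.trans (link_of_adj hab), fun h => h.trans (link_of_adj hab).symm⟩

variable [Fintype V]

theorem SplitConnected.mem_degSpace {D : Digraph V} (hD : D.SplitConnected)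
    {p : V ⊕ V → ZMod 2} (hp : ∀ x, p x ≠ 0 → D.Active x) (h : ∑ x, p x = 0) :
    p ∈ D.degSpace := by
  by_cases h0 : ∃ x, D.Active x
  · obtain ⟨x₀, hx₀⟩ := h0
    exact mem_degSpace_of_sum_eq_zero x₀ (fun x hx => hD.link (hp x hx) hx₀) h
  · have : p = 0 := funext fun x => by
      by_contra hx
      exact h0 ⟨x, hp x hx⟩
    rw [this]
    exact Submodule.zero_mem _

/-- A vector satisfying all parity conditions, not necessarily realized by a set of arcs. -/
noncomputable def baseVec (D : Digraph V) (m : V → ZMod 2) : V ⊕ V → ZMod 2 :=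
  Sum.elim (fun v => if (∃ u, D.Adj v u) ∧ D.wOut m v = 0 then m v else 0)
    (fun v => if (∃ u, D.Adj u v) ∧ D.wIn m v = 0 then m v else 0)

theorem baseVec_active (D : Digraph V) (m : V → ZMod 2) {x : V ⊕ V} (h : D.baseVec m x ≠ 0) :
    D.Active x := by
  rcases x with x | x <;>
  · by_contra hx
    simp only [Active, Sum.elim_inl, Sum.elim_inr] at hx
    simp [baseVec, hx] at h

theorem parityOk_baseVec (D : Digraph V) (m : V → ZMod 2) (v : V) :
    D.ParityOk m (D.baseVec m) v := by
  refine ⟨fun h1 h2 => if_pos ⟨h1, h2⟩, fun h1 h2 => if_pos ⟨h1, h2⟩, fun _ _ h3 h4 => ?_⟩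
  simp [baseVec, h3, h4]

theorem ParityOk.congr {D : Digraph V} {m : V → ZMod 2} {p q : V ⊕ V → ZMod 2} {v : V}
    (h : D.ParityOk m p v) (h1 : q (Sum.inl v) = p (Sum.inl v))
    (h2 : q (Sum.inr v) = p (Sum.inr v)) : D.ParityOk m q v := by
  unfold ParityOk
  rw [h1, h2]
  exact h

/-- A vertex with degrees of different parities has a node at which the parity is arbitrary. -/
theorem exists_free_node (D : Digraph V) (m : V → ZMod 2) {v : V}
    (hv : D.wOut m v + D.wIn m v = 1) : ∃ x, (x = Sum.inl v ∨ x = Sum.inr v) ∧ D.Active x ∧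
      ∀ (p : V ⊕ V → ZMod 2) (t : ZMod 2) (w : V),
        D.ParityOk m p w → D.ParityOk m (p + t • nodeVec x) w := by
  -- An odd weight needs a nonempty semi-cut, so the node to be freed is active. It is the one on
  -- the odd side: only the even side carries a condition.
  have hout : D.wOut m v = 1 → ∃ u, D.Adj v u := fun h => by
    by_contra hne
    rw [wOut, Finset.sum_eq_zero fun u _ => if_neg fun hu => hne ⟨u, hu⟩] at h
    exact zero_ne_one h
  have hin : D.wIn m v = 1 → ∃ u, D.Adj u v := fun h => by
    by_contra hne
    rw [wIn, Finset.sum_eq_zero fun u _ => if_neg fun hu => hne ⟨u, hu⟩] at h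
    exact zero_ne_one h
  rcases zmod_two_eq_or (D.wOut m v) with h | h
  · rw [h, zero_add] at hv
    refine ⟨Sum.inr v, Or.inr rfl, hin hv, fun p t w hw => ?_⟩
    by_cases hwv : w = v
    · subst hwv
      refine ⟨fun h1 h2 => ?_, fun h1 h2 => ?_, fun _ _ h3 _ => ?_⟩
      · simpa [nodeVec] using hw.1 h1 h2
      · simp [hv] at h2
      · simp [h] at h3
    · exact hw.congr (by simp [nodeVec]) (by simp [nodeVec, hwv])
  · rw [h] at hv
    have hv' : D.wIn m v = 0 := by simpa using hv
    refine ⟨Sum.inl v, Or.inl rfl, hout h, fun p t w hw => ?_⟩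
    by_cases hwv : w = v
    · subst hwv
      refine ⟨fun h1 h2 => ?_, fun h1 h2 => ?_, fun _ _ _ h3 => ?_⟩
      · simp [h] at h2
      · simpa [nodeVec] using hw.2.1 h1 h2
      · simp [hv'] at h3
    · exact hw.congr (by simp [nodeVec, hwv]) (by simp [nodeVec])

theorem sum_nodeVec (x : V ⊕ V) : ∑ y, nodeVec x y = 1 := by
  simp only [nodeVec, Finset.sum_ite_eq', Finset.mem_univ, if_true]

theorem SplitConnected.add_smul_nodeVec_mem {D : Digraph V} (hD : D.SplitConnected)
    (m : V → ZMod 2) {x : V ⊕ V} (hx : D.Active x) :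
    D.baseVec m + (∑ y, D.baseVec m y) • nodeVec x ∈ D.degSpace := by
  refine hD.mem_degSpace (fun y hy => ?_) ?_
  · by_cases hyx : y = x
    · rwa [hyx]
    · refine D.baseVec_active m (x := y) fun h => hy ?_
      simp [h, nodeVec, hyx]
  · simp only [Pi.add_apply, Pi.smul_apply, Finset.sum_add_distrib, smul_eq_mul,
      ← Finset.mul_sum, sum_nodeVec, mul_one]
    exact CharTwo.add_self_eq_zero _

theorem SplitConnected.exists_parityOk_except {D : Digraph V} (hD : D.SplitConnected)
    (m : V → ZMod 2) {v₀ u : V} (h : D.Adj v₀ u) :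
    ∃ p ∈ D.degSpace, ∀ v, v ≠ v₀ → D.ParityOk m p v := by
  have hx : D.Active (Sum.inl v₀) := ⟨u, h⟩
  refine ⟨_, hD.add_smul_nodeVec_mem m hx, fun v hv => (D.parityOk_baseVec m v).congr ?_ ?_⟩
  · simp [nodeVec, hv]
  · simp [nodeVec]

theorem IsTournament.wOut_add_wIn {T : Digraph V} (hT : T.IsTournament) (m : V → ZMod 2)
    (v : V) : T.wOut m v + T.wIn m v = m v + ∑ u, m u := by
  have h1 : T.wOut m v + T.wIn m v + m v = ∑ u, m u := by
    have : m v = ∑ u, if u = v then m u else 0 := by simp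
    rw [wOut, wIn, this, ← Finset.sum_add_distrib, ← Finset.sum_add_distrib]
    refine Finset.sum_congr rfl fun u _ => ?_
    by_cases huv : u = v
    · subst huv
      simp [hT.loopless]
    · rcases hT.adj_or huv with h | h <;> simp [h, hT.asymm h, huv]
  rw [← h1, add_comm (m v), add_assoc, CharTwo.add_self_eq_zero, add_zero]

/-- Failure means that `baseVec` has odd total and that no free node exists to correct it. -/
theorem IsTournament.source_or_sink_of_splitConnected {T : Digraph V} (hT : T.IsTournament)
    (hC : T.SplitConnected) (m : V → ZMod 2)
    (h : ¬ ∃ p ∈ T.degSpace, ∀ v, T.ParityOk m p v) :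
    (∀ v, m v = 1) ∧ Odd (Fintype.card V) ∧
      (((∃ s, ∀ u, ¬ T.Adj u s) ∧ ∀ v, ∃ u, T.Adj v u) ∨
        ((∃ s, ∀ u, ¬ T.Adj s u) ∧ ∀ v, ∃ u, T.Adj u v)) := by
  have hS : ∑ y, T.baseVec m y = 1 := by
    refine (zmod_two_eq_or _).resolve_left fun h0 => h ⟨T.baseVec m, ?_, T.parityOk_baseVec m⟩
    exact hC.mem_degSpace (fun x => T.baseVec_active m) h0
  have hmix : ∀ v, T.wOut m v + T.wIn m v = 0 := fun v => by
    refine (zmod_two_eq_or _).resolve_right fun h1 => h ?_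
    obtain ⟨x, -, hx, hx'⟩ := T.exists_free_node m h1
    exact ⟨_, hC.add_smul_nodeVec_mem m hx, fun w => hx' _ _ w (T.parityOk_baseVec m w)⟩
  -- Weighted out- and in-degree add up to the total minus `m v`; equal parities thus make every
  -- weight equal to the total.
  have hm : ∀ v, m v = ∑ u, m u := fun v => by
    have := hmix v
    rw [hT.wOut_add_wIn] at this
    exact CharTwo.add_eq_zero.1 this
  have hM : ∑ u, m u = 1 := by
    refine (zmod_two_eq_or _).resolve_left fun h0 => zero_ne_one (α := ZMod 2) ?_
    rw [← hS]
    refine (Finset.sum_eq_zero fun x _ => ?_).symm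
    rcases x with x | x <;> simp [baseVec, hm x, h0]
  have hm1 : ∀ v, m v = 1 := fun v => (hm v).trans hM
  refine ⟨hm1, ?_, ?_⟩
  · rw [← ZMod.natCast_eq_one_iff_odd, ← hM]
    simp [hm1]
  · obtain ⟨A, hA⟩ : ∃ A : V → Prop, ∀ v, A v ↔ ∀ u, ¬ T.Adj u v := ⟨_, fun _ => Iff.rfl⟩
    obtain ⟨B, hB⟩ : ∃ B : V → Prop, ∀ v, B v ↔ ∀ u, ¬ T.Adj v u := ⟨_, fun _ => Iff.rfl⟩
    have hsum : ∑ v, (T.baseVec m (Sum.inl v) + T.baseVec m (Sum.inr v)) = 1 := by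
      rw [Finset.sum_add_distrib, ← Fintype.sum_sum_type]
      exact hS
    -- At a vertex with two nonempty semi-cuts the out- and in-values cancel. A source or sink has
    -- even weight on both sides, and its only active node contributes 1.
    have hterm : ∀ v, T.baseVec m (Sum.inl v) + T.baseVec m (Sum.inr v) =
        (if A v then 1 else 0) + (if B v then 1 else 0) := by
      intro v
      have h2 := CharTwo.add_eq_zero.1 (hmix v)
      by_cases ho : ∃ u, T.Adj v u <;> by_cases hi : ∃ u, T.Adj u v
      · have ho' : ¬ ∀ u, ¬ T.Adj v u := not_forall_not.2 ho
        have hi' : ¬ ∀ u, ¬ T.Adj u v := not_forall_not.2 hi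
        rw [if_neg (mt (hA v).1 hi'), if_neg (mt (hB v).1 ho')]
        simp only [baseVec, Sum.elim_inl, Sum.elim_inr, ho, hi, true_and, h2]
        rw [CharTwo.add_self_eq_zero, add_zero]
      · have ho' : ¬ ∀ u, ¬ T.Adj v u := not_forall_not.2 ho
        have hi' : ∀ u, ¬ T.Adj u v := not_exists.1 hi
        have : T.wOut m v = 0 := by
          rw [h2, wIn]
          exact Finset.sum_eq_zero fun u _ => if_neg (hi' u)
        rw [if_pos ((hA v).2 hi'), if_neg (mt (hB v).1 ho')]
        simp [baseVec, ho, hi, this, hm1]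
      · have ho' : ∀ u, ¬ T.Adj v u := not_exists.1 ho
        have hi' : ¬ ∀ u, ¬ T.Adj u v := not_forall_not.2 hi
        have : T.wIn m v = 0 := by
          rw [← h2, wOut]
          exact Finset.sum_eq_zero fun u _ => if_neg (ho' u)
        rw [if_neg (mt (hA v).1 hi'), if_pos ((hB v).2 ho')]
        simp [baseVec, ho, hi, this, hm1]
      · have ho' : ∀ u, ¬ T.Adj v u := not_exists.1 ho
        have hi' : ∀ u, ¬ T.Adj u v := not_exists.1 hi
        rw [if_pos ((hA v).2 hi'), if_pos ((hB v).2 ho')]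
        simp only [baseVec, Sum.elim_inl, Sum.elim_inr, ho, hi, false_and, if_false]
        decide
    simp only [hterm, Finset.sum_add_distrib] at hsum
    have hone : ∀ (R : V → Prop), (∀ a b, R a → R b → a = b) →
        (∑ v, if R v then (1 : ZMod 2) else 0) = if ∃ v, R v then 1 else 0 := by
      intro R hR
      split_ifs with hex
      · obtain ⟨s, hs⟩ := hex
        rw [Finset.sum_eq_single s (fun b _ hb => if_neg fun h' => hb (hR _ _ h' hs)) (by simp),
          if_pos hs]
      · exact Finset.sum_eq_zero fun v _ => if_neg fun h' => hex ⟨v, h'⟩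
    rw [hone A, hone B] at hsum
    · by_cases h1 : ∃ s, A s <;> by_cases h2 : ∃ s, B s
      · rw [if_pos h1, if_pos h2, CharTwo.add_self_eq_zero] at hsum
        exact absurd hsum zero_ne_one
      · exact Or.inl ⟨h1.imp fun s => (hA s).1,
          fun v => not_forall_not.1 (mt (hB v).2 (not_exists.1 h2 v))⟩
      · exact Or.inr ⟨h2.imp fun s => (hB s).1,
          fun v => not_forall_not.1 (mt (hA v).2 (not_exists.1 h1 v))⟩
      · rw [if_neg h1, if_neg h2, add_zero] at hsum
        exact absurd hsum zero_ne_one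
    · intro a b ha hb
      by_contra hab
      exact (hT.adj_or hab).elim ((hB a).1 ha _) ((hB b).1 hb _)
    · intro a b ha hb
      by_contra hab
      exact (hT.adj_or hab).elim ((hA b).1 hb _) ((hA a).1 ha _)

end Digraph

/-! ### Tournaments with a bridge -/

namespace Digraph

universe u w

variable {V : Type u}

namespace IsBridge

variable {T : Digraph V} {r q : V}

theorem adj_left_iff (hb : T.IsBridge r q) (hT : T.IsTournament) (u : V) :
    T.Adj r u ↔ u = q := by
  refine ⟨fun h => by_contra fun hu => ?_, fun h => h ▸ hb.adj⟩
  exact hT.asymm h (hb.adj_right u (hT.ne h).symm hu)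

theorem adj_right_iff (hb : T.IsBridge r q) (hT : T.IsTournament) (u : V) :
    T.Adj u q ↔ u = r := by
  refine ⟨fun h => by_contra fun hu => ?_, fun h => h ▸ hb.adj⟩
  exact hT.asymm h (hb.adj_left u hu (hT.ne h))

theorem right_adj_iff (hb : T.IsBridge r q) (hT : T.IsTournament) (u : V) :
    T.Adj q u ↔ u ≠ r ∧ u ≠ q := by
  refine ⟨fun h => ⟨?_, (hT.ne h).symm⟩, fun h => hb.adj_left u h.1 h.2⟩
  rintro rfl
  exact hT.asymm h hb.adj

theorem adj_left_iff' (hb : T.IsBridge r q) (hT : T.IsTournament) (u : V) :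
    T.Adj u r ↔ u ≠ r ∧ u ≠ q := by
  refine ⟨fun h => ⟨hT.ne h, ?_⟩, fun h => hb.adj_right u h.1 h.2⟩
  rintro rfl
  exact hT.asymm h hb.adj

theorem active (hb : T.IsBridge r q) (x : V ⊕ V) : T.Active x := by
  obtain ⟨p, hp1, hp2⟩ := hb.exists_other
  rcases x with x | x
  · by_cases hr : x = r
    · exact ⟨q, hr ▸ hb.adj⟩
    · by_cases hq : x = q
      · exact ⟨p, hq ▸ hb.adj_left p hp1 hp2⟩
      · exact ⟨r, hb.adj_right x hr hq⟩
  · by_cases hq : x = q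
    · exact ⟨r, hq ▸ hb.adj⟩
    · by_cases hr : x = r
      · exact ⟨p, hr ▸ hb.adj_right p hp1 hp2⟩
      · exact ⟨q, hb.adj_left x hr hq⟩

/-- With at least two further vertices, the split graph has just one other component. -/
theorem link (hb : T.IsBridge r q) {a b : V} (hab : T.Adj a b) (har : a ≠ r) (haq : a ≠ q)
    (hbr : b ≠ r) (hbq : b ≠ q) (x : V ⊕ V) (hx : x ≠ Sum.inl r) (hx' : x ≠ Sum.inr q) :
    T.Link x (Sum.inl q) := by
  have h1 : ∀ p, p ≠ r → p ≠ q → T.Link (Sum.inr p) (Sum.inl q) := fun p hpr hpq =>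
    (link_of_adj (hb.adj_left p hpr hpq)).symm
  have h2 : T.Link (Sum.inl a) (Sum.inl q) := (link_of_adj hab).trans (h1 b hbr hbq)
  have h3 : T.Link (Sum.inr r) (Sum.inl q) :=
    (link_of_adj (hb.adj_right a har haq)).symm.trans h2
  rcases x with x | x
  · by_cases hxq : x = q
    · exact hxq ▸ Link.refl _ _
    · exact (link_of_adj (hb.adj_right x (fun h => hx (h ▸ rfl)) hxq)).trans h3
  · by_cases hxr : x = r
    · exact hxr ▸ h3
    · exact h1 x hxr fun h => hx' (h ▸ rfl)

theorem ne (hb : T.IsBridge r q) (hT : T.IsTournament) : r ≠ q := hT.ne hb.adj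

variable [Fintype V]

/-- Adding a multiple of the vector of the arc `rq` clears both nodes of its component; the rest
lies in the other component and has even sum. -/
theorem mem_degSpace (hb : T.IsBridge r q) {a b : V} (hab : T.Adj a b) (har : a ≠ r)
    (haq : a ≠ q) (hbr : b ≠ r) (hbq : b ≠ q) {p : V ⊕ V → ZMod 2}
    (hp : p (Sum.inl r) = p (Sum.inr q)) (hs : ∑ x, p x = 0) : p ∈ T.degSpace := by
  have hmem : p (Sum.inl r) • arcVec r q ∈ T.degSpace :=
    Submodule.smul_mem _ _ (arcVec_mem hb.adj)
  refine (Submodule.add_mem_iff_left _ hmem).1 ?_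
  refine mem_degSpace_of_sum_eq_zero (Sum.inl q) (fun x hx => ?_) ?_
  · refine hb.link hab har haq hbr hbq x ?_ ?_
    · rintro rfl
      refine hx ?_
      simp [arcVec, nodeVec, CharTwo.add_self_eq_zero]
    · rintro rfl
      refine hx ?_
      simp [arcVec, nodeVec, hp, CharTwo.add_self_eq_zero]
  · simp only [Pi.add_apply, Pi.smul_apply, Finset.sum_add_distrib, smul_eq_mul,
      ← Finset.mul_sum, arcVec, sum_nodeVec, hs]
    rw [CharTwo.add_self_eq_zero, mul_zero, add_zero]

end IsBridge

variable [Fintype V]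

theorem sum_eq_add_add_sum_ite {r q : V} (h : r ≠ q) (g : V → ZMod 2) :
    ∑ v, g v = g r + g q + ∑ v, if v ≠ r ∧ v ≠ q then g v else 0 := by
  have h1 : g r = ∑ v, if v = r then g v else 0 := by simp
  have h2 : g q = ∑ v, if v = q then g v else 0 := by simp
  rw [h1, h2, ← Finset.sum_add_distrib, ← Finset.sum_add_distrib]
  refine Finset.sum_congr rfl fun v _ => ?_
  by_cases hr : v = r
  · subst hr
    simp [h]
  · by_cases hq : v = q
    · subst hq
      simp [hr]
    · simp [hr, hq]

namespace IsBridge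

variable {T : Digraph V} {r q : V}

theorem wOut_left (hb : T.IsBridge r q) (hT : T.IsTournament) (m : V → ZMod 2) :
    T.wOut m r = m q := by
  simp [wOut, hb.adj_left_iff hT]

theorem wIn_right (hb : T.IsBridge r q) (hT : T.IsTournament) (m : V → ZMod 2) :
    T.wIn m q = m r := by
  simp [wIn, hb.adj_right_iff hT]

theorem wOut_right (hb : T.IsBridge r q) (hT : T.IsTournament) (m : V → ZMod 2) :
    T.wOut m q = ∑ v, if v ≠ r ∧ v ≠ q then m v else 0 :=
  Finset.sum_congr rfl fun u _ => by simp only [hb.right_adj_iff hT]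

theorem wIn_left (hb : T.IsBridge r q) (hT : T.IsTournament) (m : V → ZMod 2) :
    T.wIn m r = ∑ v, if v ≠ r ∧ v ≠ q then m v else 0 :=
  Finset.sum_congr rfl fun u _ => by simp only [hb.adj_left_iff' hT]

/-- The vector with prescribed values at the ends of a bridge, extended by `baseVec`. -/
noncomputable def _root_.Digraph.bridgeVec (T : Digraph V) (m : V → ZMod 2) (r q : V)
    (a b c : ZMod 2) : V ⊕ V → ZMod 2 :=
  Sum.elim (fun v => if v = r then a else if v = q then c else T.baseVec m (Sum.inl v))
    (fun v => if v = r then b else if v = q then a else T.baseVec m (Sum.inr v))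

theorem sum_bridgeVec (hrq : r ≠ q) (m : V → ZMod 2) (a b c : ZMod 2) :
    ∑ x, T.bridgeVec m r q a b c x = a + b + c + a + ∑ v, if v ≠ r ∧ v ≠ q then
      T.baseVec m (Sum.inl v) + T.baseVec m (Sum.inr v) else 0 := by
  rw [Fintype.sum_sum_type, ← Finset.sum_add_distrib, sum_eq_add_add_sum_ite hrq]
  congr 1
  · simp [bridgeVec, hrq.symm]
    ring
  · refine Finset.sum_congr rfl fun v _ => ?_
    split_ifs with h
    · simp [bridgeVec, h.1, h.2]
    · rfl

theorem parityOk_bridgeVec (m : V → ZMod 2) (a b c : ZMod 2) {v : V} (hr : v ≠ r) (hq : v ≠ q) :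
    T.ParityOk m (T.bridgeVec m r q a b c) v := by
  refine (T.parityOk_baseVec m v).congr ?_ ?_ <;> simp [bridgeVec, hr, hq]

theorem parityOk_bridgeVec_left (hb : T.IsBridge r q) (hT : T.IsTournament) (m : V → ZMod 2)
    {a b c : ZMod 2} (h : (m q = 0 → a = m r) ∧
      ((∑ v, if v ≠ r ∧ v ≠ q then m v else 0) = 0 → b = m r) ∧
      (m q = 1 → (∑ v, if v ≠ r ∧ v ≠ q then m v else 0) = 1 → a = b)) :
    T.ParityOk m (T.bridgeVec m r q a b c) r := by
  rw [← hb.wOut_left hT m, ← hb.wIn_left hT m] at h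
  refine ⟨fun _ => ?_, fun _ => ?_, fun _ _ => ?_⟩ <;>
    simp only [bridgeVec, Sum.elim_inl, Sum.elim_inr, if_true]
  exacts [h.1, h.2.1, h.2.2]

theorem parityOk_bridgeVec_right (hb : T.IsBridge r q) (hT : T.IsTournament) (m : V → ZMod 2)
    {a b c : ZMod 2} (h : ((∑ v, if v ≠ r ∧ v ≠ q then m v else 0) = 0 → c = m q) ∧
      (m r = 0 → a = m q) ∧
      ((∑ v, if v ≠ r ∧ v ≠ q then m v else 0) = 1 → m r = 1 → c = a)) :
    T.ParityOk m (T.bridgeVec m r q a b c) q := by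
  rw [← hb.wOut_right hT m, ← hb.wIn_right hT m] at h
  have hqr : q ≠ r := (hb.ne hT).symm
  refine ⟨fun _ => ?_, fun _ => ?_, fun _ _ => ?_⟩ <;>
    simp only [bridgeVec, Sum.elim_inl, Sum.elim_inr, if_true, if_neg hqr]
  exacts [h.1, h.2.1, h.2.2]

theorem exists_parityOk_except (hb : T.IsBridge r q) (hT : T.IsTournament) {a b : V}
    (hab : T.Adj a b) (har : a ≠ r) (haq : a ≠ q) (hbr : b ≠ r) (hbq : b ≠ q)
    (m : V → ZMod 2) : ∃ p ∈ T.degSpace, ∀ v, v ≠ q → T.ParityOk m p v := by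
  obtain ⟨x, y, z, h1, h2⟩ := exists_bridge_exempt (m r) (m q)
    (∑ v, if v ≠ r ∧ v ≠ q then m v else 0) (∑ v, if v ≠ r ∧ v ≠ q then
      T.baseVec m (Sum.inl v) + T.baseVec m (Sum.inr v) else 0)
  refine ⟨T.bridgeVec m r q x y z, hb.mem_degSpace hab har haq hbr hbq ?_ ?_, fun v hv => ?_⟩
  · simp [bridgeVec, (hb.ne hT).symm]
  · rw [sum_bridgeVec (hb.ne hT), h2]
  · by_cases hr : v = r
    · subst hr
      exact hb.parityOk_bridgeVec_left hT m h1
    · exact parityOk_bridgeVec m x y z hr hv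

/-- `bridgeVec` reduces the task to choosing three values at `r` and `q` with the right total. A
further vertex with degrees of different parities makes the total adjustable. -/
theorem exists_parityOk (hb : T.IsBridge r q) (hT : T.IsTournament) {a b : V}
    (hab : T.Adj a b) (har : a ≠ r) (haq : a ≠ q) (hbr : b ≠ r) (hbq : b ≠ q)
    (m : V → ZMod 2) (h : ¬ (m r + m q = 1 ∧ (∑ v, if v ≠ r ∧ v ≠ q then m v else 0) = 0 ∧
      ∀ v, v ≠ r → v ≠ q → m v = 1)) :
    ∃ p ∈ T.degSpace, ∀ v, T.ParityOk m p v := by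
  set π := ∑ v, if v ≠ r ∧ v ≠ q then m v else 0 with hπ
  have hrq := hb.ne hT
  have hval : ∀ x y z, T.bridgeVec m r q x y z (Sum.inl r)
      = T.bridgeVec m r q x y z (Sum.inr q) := fun x y z => by simp [bridgeVec, hrq.symm]
  have hok : ∀ x y z, ((m q = 0 → x = m r) ∧ (π = 0 → y = m r) ∧ (m q = 1 → π = 1 → x = y)) →
      ((π = 0 → z = m q) ∧ (m r = 0 → x = m q) ∧ (π = 1 → m r = 1 → z = x)) →
      ∀ v, T.ParityOk m (T.bridgeVec m r q x y z) v := by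
    intro x y z h1 h2 v
    by_cases hr : v = r
    · subst hr
      exact hb.parityOk_bridgeVec_left hT m h1
    · by_cases hq : v = q
      · subst hq
        exact hb.parityOk_bridgeVec_right hT m h2
      · exact parityOk_bridgeVec m x y z hr hq
  by_cases hmix : ∃ v, v ≠ r ∧ v ≠ q ∧ T.wOut m v + T.wIn m v = 1
  · obtain ⟨v, hvr, hvq, hv⟩ := hmix
    obtain ⟨n, hn, -, hfree⟩ := T.exists_free_node m hv
    obtain ⟨x, y, z, t, h1, h2, h3⟩ := exists_bridge_flexible (m r) (m q) π
      (∑ v, if v ≠ r ∧ v ≠ q then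
        T.baseVec m (Sum.inl v) + T.baseVec m (Sum.inr v) else 0)
    refine ⟨T.bridgeVec m r q x y z + t • nodeVec n,
      hb.mem_degSpace hab har haq hbr hbq ?_ ?_, fun w => hfree _ _ _ (hok x y z h1 h2 w)⟩
    · have e1 : nodeVec n (Sum.inl r) = 0 := by
        rcases hn with rfl | rfl <;> simp [nodeVec, hvr.symm]
      have e2 : nodeVec n (Sum.inr q) = 0 := by
        rcases hn with rfl | rfl <;> simp [nodeVec, hvq.symm]
      simp [e1, e2, hval]
    · simp only [Pi.add_apply, Pi.smul_apply, Finset.sum_add_distrib, smul_eq_mul,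
        ← Finset.mul_sum, sum_nodeVec, sum_bridgeVec hrq, mul_one]
      exact h3
  · have hunm : ∀ v, v ≠ r → v ≠ q → T.wOut m v = T.wIn m v := fun v hr hq =>
      CharTwo.add_eq_zero.1 ((zmod_two_eq_or _).resolve_right fun h' => hmix ⟨v, hr, hq, h'⟩)
    have hρ : (∑ v, if v ≠ r ∧ v ≠ q then
        T.baseVec m (Sum.inl v) + T.baseVec m (Sum.inr v) else 0) = 0 := by
      refine Finset.sum_eq_zero fun v _ => ?_
      split_ifs with hv
      · have h1 : ∃ u, T.Adj v u := hb.active (Sum.inl v)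
        have h2 : ∃ u, T.Adj u v := hb.active (Sum.inr v)
        simp only [baseVec, Sum.elim_inl, Sum.elim_inr, h1, h2, true_and, hunm v hv.1 hv.2]
        exact CharTwo.add_self_eq_zero _
      · rfl
    -- In this case the total weight is 1, and each remaining vertex, having equal degree parities,
    -- has weight equal to the total: the excluded configuration.
    have hnot : ¬ (m r + m q = 1 ∧ π = 0) := by
      rintro ⟨h1, h2⟩
      refine h ⟨h1, h2, fun v hr hq => ?_⟩
      have h3 := hT.wOut_add_wIn m v
      rw [hunm v hr hq, CharTwo.add_self_eq_zero, sum_eq_add_add_sum_ite hrq, h1, ← hπ, h2,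
        add_zero] at h3
      exact CharTwo.add_eq_zero.1 h3.symm
    obtain ⟨x, y, z, h1, h2, h3⟩ := exists_bridge (m r) (m q) π hnot
    refine ⟨T.bridgeVec m r q x y z, hb.mem_degSpace hab har haq hbr hbq (hval x y z) ?_,
      hok x y z h1 h2⟩
    rw [sum_bridgeVec hrq, hρ, add_zero, h3]

/-- Out- and in-degrees have the same total. The other vertices cancel, the arc `rq` counts twice,
and the forced values at `r` and `q` leave `m r + m q = 1`. -/
theorem not_exists_parityOk (hb : T.IsBridge r q) (hT : T.IsTournament)
    (m : V → ZMod 2) (h1 : m r + m q = 1)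
    (h2 : (∑ v, if v ≠ r ∧ v ≠ q then m v else 0) = 0)
    (h3 : ∀ v, v ≠ r → v ≠ q → m v = 1) :
    ¬ ∃ p ∈ T.degSpace, ∀ v, T.ParityOk m p v := by
  rintro ⟨p, hp, hok⟩
  have hrq := hb.ne hT
  obtain ⟨f, f1, f2, f3⟩ := mem_degSpace_iff.1 hp
  have e1 : p (Sum.inl r) = f r q := by
    rw [f2]
    exact Finset.sum_eq_single q (fun v _ hv => f1 _ _ (mt (hb.adj_left_iff hT v).1 hv)) (by simp)
  have e2 : p (Sum.inr q) = f r q := by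
    rw [f3]
    exact Finset.sum_eq_single r (fun v _ hv => f1 _ _ (mt (hb.adj_right_iff hT v).1 hv)) (by simp)
  have e3 : ∑ v, (p (Sum.inl v) + p (Sum.inr v)) = 0 := by
    simp only [Finset.sum_add_distrib, f2, f3]
    rw [Finset.sum_comm]
    exact CharTwo.add_self_eq_zero _
  have act : ∀ v, (∃ u, T.Adj v u) ∧ ∃ u, T.Adj u v := fun v =>
    ⟨hb.active (Sum.inl v), hb.active (Sum.inr v)⟩
  have e4 : (∑ v, if v ≠ r ∧ v ≠ q then p (Sum.inl v) + p (Sum.inr v) else 0) = 0 := by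
    refine Finset.sum_eq_zero fun v _ => ?_
    split_ifs with hv
    · have h4 := hT.wOut_add_wIn m v
      rw [sum_eq_add_add_sum_ite hrq, h1, h2, h3 v hv.1 hv.2, add_zero,
        CharTwo.add_self_eq_zero] at h4
      have h5 := CharTwo.add_eq_zero.1 h4
      rw [CharTwo.add_eq_zero]
      obtain ⟨k1, k2, k3⟩ := hok v
      rcases zmod_two_eq_or (T.wOut m v) with h6 | h6
      · rw [k1 (act v).1 h6, k2 (act v).2 (h5 ▸ h6)]
      · exact k3 (act v).1 (act v).2 h6 (h5 ▸ h6)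
    · rfl
  have e5 : p (Sum.inr r) = m r :=
    (hok r).2.1 (act r).2 ((hb.wIn_left hT m).trans h2)
  have e6 : p (Sum.inl q) = m q :=
    (hok q).1 (act q).1 ((hb.wOut_right hT m).trans h2)
  rw [sum_eq_add_add_sum_ite hrq, e4, e1, e2, e5, e6, add_zero] at e3
  have : f r q + m r + (m q + f r q) = (m r + m q) + (f r q + f r q) := by ring
  rw [this, h1, CharTwo.add_self_eq_zero, add_zero] at e3
  exact one_ne_zero e3

/-- A blow-up of the cyclic triangle satisfies all parity conditions. -/
theorem exists_parityOk_of_triangle (hb : T.IsBridge r q) (hT : T.IsTournament) {p : V}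
    (hpr : p ≠ r) (hpq : p ≠ q) (hp : ∀ v, v = r ∨ v = q ∨ v = p) (m : V → ZMod 2) :
    ∃ x ∈ T.degSpace, ∀ v, T.ParityOk m x v := by
  have hrq := hb.ne hT
  have aqp := hb.adj_left p hpr hpq
  have apr := hb.adj_right p hpr hpq
  -- Each arc of the cyclic triangle is a bridge, so all semi-cuts are single arcs.
  have hb1 : T.IsBridge q p := by
    refine ⟨aqp, ⟨r, hrq, hpr.symm⟩, fun v h1 h2 => ?_, fun v h1 h2 => ?_⟩ <;>
      obtain rfl := (hp v).resolve_right (by simp [h1, h2])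
    exacts [apr, hb.adj]
  have hb2 : T.IsBridge p r := by
    refine ⟨apr, ⟨q, hpq.symm, hrq.symm⟩, fun v h1 h2 => ?_, fun v h1 h2 => ?_⟩ <;>
      obtain rfl := ((hp v).resolve_left h2).resolve_right h1
    exacts [hb.adj, aqp]
  obtain ⟨a, b, c, h1, h2, h3⟩ := exists_triangle (m r) (m q) (m p)
  refine ⟨a • arcVec r q + b • arcVec q p + c • arcVec p r, ?_, fun v => ?_⟩
  · exact Submodule.add_mem _ (Submodule.add_mem _ (Submodule.smul_mem _ _ (arcVec_mem hb.adj))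
      (Submodule.smul_mem _ _ (arcVec_mem aqp))) (Submodule.smul_mem _ _ (arcVec_mem apr))
  · rcases hp v with rfl | rfl | rfl
    · rw [← hb.wOut_left hT m, ← hb2.wIn_right hT m] at h1
      refine ⟨fun _ => ?_, fun _ => ?_, fun _ _ => ?_⟩ <;>
        simp [arcVec, nodeVec, hrq, hpr.symm]
      exacts [h1.1, h1.2.1, h1.2.2]
    · rw [← hb1.wOut_left hT m, ← hb.wIn_right hT m] at h2
      refine ⟨fun _ => ?_, fun _ => ?_, fun _ _ => ?_⟩ <;>
        simp [arcVec, nodeVec, hrq.symm, hpq.symm]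
      exacts [h2.1, h2.2.1, h2.2.2]
    · rw [← hb2.wOut_left hT m, ← hb1.wIn_right hT m] at h3
      refine ⟨fun _ => ?_, fun _ => ?_, fun _ _ => ?_⟩ <;>
        simp [arcVec, nodeVec, hpr, hpq]
      exacts [h3.1, h3.2.1, h3.2.2]

end IsBridge

end Digraph

/-! ### The third color, bad blow-ups and the final case analysis -/

namespace Digraph

universe u w

variable {V : Type u}

/-- Removal of the arc from `s` to `u`. -/
def deleteArc (D : Digraph V) (s u : V) : Digraph V where
  Adj a b := D.Adj a b ∧ ¬ (a = s ∧ b = u)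

/-- A walk `s`, `a`, `b`, `c` along arcs either gives `c` the in-neighbours `a` and `b`, or closes a
cyclic triangle. In the latter case any further vertex `d` yields such a pair. -/
theorem IsTournament.exists_two_inNbrs [Fintype V] {T : Digraph V} (hT : T.IsTournament)
    (hodd : Odd (Fintype.card V)) {s : V} (hs : ∀ u, ¬ T.Adj u s) (hsink : ∀ v, ∃ u, T.Adj v u) :
    ∃ u a b, a ≠ s ∧ b ≠ s ∧ T.Adj a u ∧ T.Adj b u ∧ T.Adj a b := by
  have suff : ∀ u a b, a ≠ s → b ≠ s → a ≠ b → T.Adj a u → T.Adj b u →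
      ∃ u a b, a ≠ s ∧ b ≠ s ∧ T.Adj a u ∧ T.Adj b u ∧ T.Adj a b := by
    intro u a b ha hb hab hau hbu
    rcases hT.adj_or hab with h | h
    · exact ⟨u, a, b, ha, hb, hau, hbu, h⟩
    · exact ⟨u, b, a, hb, ha, hbu, hau, h⟩
  have hns : ∀ {x y}, T.Adj x y → y ≠ s := by
    rintro x y h rfl
    exact hs _ h
  obtain ⟨a, ha⟩ := hsink s
  obtain ⟨b, hb⟩ := hsink a
  obtain ⟨c, hc⟩ := hsink b
  have has := hns ha
  have hbs := hns hb
  have hcs := hns hc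
  have hab := hT.ne hb
  have hbc := hT.ne hc
  have hac : a ≠ c := by
    rintro rfl
    exact hT.asymm hb hc
  rcases hT.adj_or hac with h | hca
  · exact suff c a b has hbs hab h hc
  -- The four vertices `s`, `a`, `b`, `c` cannot be all of them, as the order is odd.
  have hd : ∃ d, d ≠ s ∧ d ≠ a ∧ d ≠ b ∧ d ≠ c := by
    by_contra hd
    have : (Finset.univ : Finset V) = {s, a, b, c} := by
      ext x
      simp only [Finset.mem_univ, Finset.mem_insert, Finset.mem_singleton, true_iff]
      by_contra hx
      simp only [not_or] at hx
      exact hd ⟨x, hx⟩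
    have hcard : ({s, a, b, c} : Finset V).card = 4 := by
      rw [Finset.card_insert_of_notMem (by simp [has.symm, hbs.symm, hcs.symm]),
        Finset.card_insert_of_notMem (by simp [hab, hac]), Finset.card_pair hbc]
    rw [← Finset.card_univ, this, hcard] at hodd
    exact absurd hodd (by decide)
  obtain ⟨d, hds, hda, hdb, hdc⟩ := hd
  rcases hT.adj_or hda with h | h1
  · exact suff a c d hcs hds hdc.symm hca h
  rcases hT.adj_or hdb with h | h2
  · exact suff b a d has hds hda.symm hb h
  · exact suff d a b has hbs hab h1 h2

variable [Fintype V]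

/-- The arc `su` alone gets the third color, which settles `s` since nothing enters it. What remains
is still split-connected, hence 2-colorable with all vertices but `s` satisfied. -/
theorem IsTournament.weakOddColorable_three_of_source {T : Digraph V} (hT : T.IsTournament)
    (hodd : Odd (Fintype.card V)) {s : V} (hs : ∀ u, ¬ T.Adj u s) (hsink : ∀ v, ∃ u, T.Adj v u) :
    T.WeakOddColorable 3 := by
  obtain ⟨u, a, b, has, hbs, hau, hbu, hab⟩ := hT.exists_two_inNbrs hodd hs hsink
  have hus : u ≠ s := by
    rintro rfl
    exact hs _ hau
  have hsadj : ∀ v, v ≠ s → T.Adj s v := fun v hv => (hT.adj_or hv).resolve_left (hs v)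
  set D := T.deleteArc s u with hD
  have dadj : ∀ x y, x ≠ s ∨ y ≠ u → (D.Adj x y ↔ T.Adj x y) := fun x y h =>
    and_iff_left (by tauto)
  have hDs : ∀ v, v ≠ s → v ≠ u → D.Adj s v := fun v h1 h2 => (dadj s v (Or.inr h2)).2 (hsadj v h1)
  have hbu' : b ≠ u := hT.ne hbu
  -- Without the arc `su`, the in-node of `u` is joined to `s` through `a`, then `b`.
  have hlu : D.Link (Sum.inr u) (Sum.inl s) :=
    ((link_of_adj ((dadj a u (Or.inl has)).2 hau)).symm.trans
      (link_of_adj ((dadj a b (Or.inl has)).2 hab))).trans (link_of_adj (hDs b hbs hbu')).symm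
  have hlr : ∀ v, v ≠ s → D.Link (Sum.inr v) (Sum.inl s) := by
    intro v hv
    by_cases hvu : v = u
    · exact hvu ▸ hlu
    · exact (link_of_adj (hDs v hv hvu)).symm
  have hll : ∀ x y, D.Adj x y → D.Link (Sum.inl x) (Sum.inl s) := by
    intro x y hxy
    refine (link_of_adj hxy).trans (hlr y ?_)
    rintro rfl
    exact hs _ hxy.1
  have hconn : D.SplitConnected := fun x y x' y' h h' => (hll x y h).trans (hll x' y' h').symm
  obtain ⟨p, hp, hok⟩ := hconn.exists_parityOk_except 1 (hDs b hbs hbu')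
  obtain ⟨c, hc⟩ := D.exists_oddAt_iff hp
  rw [weakOddColorable_succ_iff]
  refine ⟨fun x y => if x = s ∧ y = u then 2 else (c x y).castSucc, fun v hv => ?_⟩
  by_cases hvs : v = s
  · subst hvs
    refine ⟨2, fun _ => ?_, fun ⟨x, hx⟩ => absurd hx (hs x)⟩
    rw [Finset.sum_eq_single u, if_pos]
    · exact ⟨hsadj u hus, if_pos ⟨rfl, rfl⟩⟩
    · intro y _ hy
      refine if_neg fun h => ?_
      have h2 : (c v y).castSucc = 2 := by simpa [hy] using h.2
      exact absurd h2 (Fin.castSucc_lt_last _).ne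
    · simp
  · have hout : (∃ y, D.Adj v y) ↔ ∃ y, T.Adj v y :=
      exists_congr fun y => dadj v y (Or.inl hvs)
    have hin : (∃ x, D.Adj x v) ↔ ∃ x, T.Adj x v := by
      refine ⟨fun ⟨x, hx⟩ => ⟨x, hx.1⟩, fun _ => ?_⟩
      by_cases hvu : v = u
      · exact ⟨a, hvu ▸ (dadj a u (Or.inl has)).2 hau⟩
      · exact ⟨s, hDs v hvs hvu⟩
    have hcol : ∀ x y i, (T.Adj x y ∧ (if x = s ∧ y = u then (2 : Fin 3) else (c x y).castSucc)
        = Fin.castSucc i) ↔ D.Adj x y ∧ c x y = i := by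
      intro x y i
      by_cases h : x = s ∧ y = u
      · rw [if_pos h]
        refine iff_of_false (fun h' => ?_) fun h' => h'.1.2 h
        exact (Fin.castSucc_lt_last i).ne h'.2.symm
      · rw [if_neg h, dadj x y (by tauto), Fin.castSucc_inj]
    obtain ⟨i, h1, h2⟩ := (hc v).2 (hok v hvs) (by rwa [hout, hin])
    rw [hout] at h1
    rw [hin] at h2
    refine ⟨i.castSucc, fun h => ?_, fun h => ?_⟩
    · simp only [hcol]
      exact h1 h
    · simp only [hcol]
      exact h2 h

/-- The even part sits at an end of the bridge: at `q` if it has a single in-neighbour, at `r` if it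
has a single out-neighbour. The dominance condition supplies the arcs at the other end. -/
theorem isBadBlowUp_iff_exists_isBridge {T : Digraph V} (hT : T.IsTournament) (I : V → Type w)
    [∀ v, Fintype (I v)] {m : V → ZMod 2} (hm : m = fun v => (Fintype.card (I v) : ZMod 2)) :
    T.IsBadBlowUp I ↔ ∃ r q, T.IsBridge r q ∧ m r + m q = 1 ∧
      (∑ v, if v ≠ r ∧ v ≠ q then m v else 0) = 0 ∧ ∀ v, v ≠ r → v ≠ q → m v = 1 := by
  have heven : ∀ v, Even (Nat.card (I v)) ↔ m v = 0 := fun v => by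
    rw [hm, Nat.card_eq_fintype_card, ZMod.natCast_eq_zero_iff_even]
  have hodd : Odd (Nat.card (Σ v, I v)) ↔ ∑ v, m v = 1 := by
    rw [hm, ← ZMod.natCast_eq_one_iff_odd, Nat.card_eq_fintype_card, Fintype.card_sigma,
      Nat.cast_sum]
  have hone : ∀ v, m v ≠ 0 ↔ m v = 1 := fun v => by
    rcases zmod_two_eq_or (m v) with h | h <;> simp [h]
  constructor
  · rintro ⟨hcard, ho, z, hz, hdom, hnbr⟩
    rw [hodd] at ho
    simp only [heven] at hz
    have hoth : ∀ r q : V, ∃ p, p ≠ r ∧ p ≠ q := by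
      intro r q
      by_contra hne
      have hsub : (Finset.univ : Finset V) ⊆ {r, q} := fun x _ => by
        by_contra hx
        simp only [Finset.mem_insert, Finset.mem_singleton, not_or] at hx
        exact hne ⟨x, hx⟩
      have h1 := Finset.card_le_card hsub
      rw [Finset.card_univ, ← Nat.card_eq_fintype_card] at h1
      have h2 := Finset.card_le_two (a := r) (b := q)
      omega
    have fin : ∀ r q, T.IsBridge r q → m r + m q = 1 → (∀ v, v ≠ r → v ≠ q → v ≠ z) →
        T.IsBridge r q ∧ m r + m q = 1 ∧
          (∑ v, if v ≠ r ∧ v ≠ q then m v else 0) = 0 ∧ ∀ v, v ≠ r → v ≠ q → m v = 1 := by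
      intro r q hb hrq h
      refine ⟨hb, hrq, ?_, fun v h1 h2 => (hone v).1 (mt (hz v).1 (h v h1 h2))⟩
      rw [sum_eq_add_add_sum_ite (hT.ne hb.adj), hrq] at ho
      simpa using ho
    have hm1 : ∀ y, y ≠ z → m y = 1 := fun y hy => (hone y).1 (mt (hz y).1 hy)
    rcases hnbr with hnbr | hnbr
    · obtain ⟨y, hy⟩ := Set.ncard_eq_one.1 hnbr
      have hy' : ∀ x, T.Adj x z ↔ x = y := fun x => Set.ext_iff.1 hy x
      have hyz : T.Adj y z := (hy' y).2 rfl
      have hout : ∀ p, p ≠ y → p ≠ z → T.Adj z p := fun p h1 h2 =>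
        (hT.adj_or h2).resolve_left (mt (hy' p).1 h1)
      refine ⟨y, z, fin y z ⟨hyz, hoth _ _, hout, fun p h1 h2 => hdom p (hout p h1 h2) y hyz⟩ ?_
        fun _ _ h => h⟩
      rw [hm1 y (hT.ne hyz), (hz z).2 rfl, add_zero]
    · obtain ⟨y, hy⟩ := Set.ncard_eq_one.1 hnbr
      have hy' : ∀ x, T.Adj z x ↔ x = y := fun x => Set.ext_iff.1 hy x
      have hzy : T.Adj z y := (hy' y).2 rfl
      have hin : ∀ p, p ≠ z → p ≠ y → T.Adj p z := fun p h1 h2 =>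
        (hT.adj_or h1).resolve_right (mt (hy' p).1 h2)
      refine ⟨z, y, fin z y ⟨hzy, hoth _ _, fun p h1 h2 => hdom y hzy p (hin p h1 h2), hin⟩ ?_
        fun _ h _ => h⟩
      rw [hm1 y (hT.ne hzy).symm, (hz z).2 rfl, zero_add]
  · rintro ⟨r, q, hb, h1, h2, h3⟩
    have hrq := hb.ne hT
    refine ⟨?_, ?_, ?_⟩
    · obtain ⟨p, hpr, hpq⟩ := hb.exists_other
      -- A single further vertex would have weight 1, contradicting the zero sum; hence at least
      -- four vertices.
      have : ∃ p', p' ≠ r ∧ p' ≠ q ∧ p' ≠ p := by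
        by_contra hne
        refine one_ne_zero (α := ZMod 2) ?_
        rw [← h2, Finset.sum_eq_single p, if_pos ⟨hpr, hpq⟩, h3 p hpr hpq]
        · exact fun b _ hbp => if_neg fun h => hne ⟨b, h.1, h.2, hbp⟩
        · simp
      obtain ⟨p', h4, h5, h6⟩ := this
      have hc : ({r, q, p, p'} : Finset V).card = 4 := by
        rw [Finset.card_insert_of_notMem (by simp [hrq, hpr.symm, h4.symm]),
          Finset.card_insert_of_notMem (by simp [hpq.symm, h5.symm]), Finset.card_pair h6.symm]
      have hle := Finset.card_le_univ ({r, q, p, p'} : Finset V)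
      rw [Nat.card_eq_fintype_card]
      omega
    · rw [hodd, sum_eq_add_add_sum_ite hrq, h1, h2, add_zero]
    · have hz : ∀ z, m z = 0 → (z = r ∨ z = q) → ∀ v, m v = 0 ↔ v = z := by
        intro z hz hzrq v
        refine ⟨fun hv => ?_, fun hv => hv ▸ hz⟩
        by_contra hvz
        have hv' : v = r ∨ v = q := by
          by_contra hne
          rw [not_or] at hne
          exact one_ne_zero ((h3 v hne.1 hne.2).symm.trans hv)
        rcases hzrq with rfl | rfl <;> rcases hv' with rfl | rfl <;>
          first
          | exact hvz rfl
          | simp [hv, hz] at h1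
      rcases zmod_two_eq_or (m q) with h | h
      · refine ⟨q, fun v => (heven v).trans (hz q h (Or.inr rfl) v), ?_, Or.inl ?_⟩
        · intro x hx y hy
          obtain rfl := (hb.adj_right_iff hT y).1 hy
          have hx' := (hb.right_adj_iff hT x).1 hx
          exact hb.adj_right x hx'.1 hx'.2
        · rw [Set.ncard_eq_one]
          exact ⟨r, Set.ext fun x => hb.adj_right_iff hT x⟩
      · have hr : m r = 0 := by simpa [h] using h1
        refine ⟨r, fun v => (heven v).trans (hz r hr (Or.inl rfl) v), ?_, Or.inr ?_⟩
        · intro x hx y hy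
          obtain rfl := (hb.adj_left_iff hT x).1 hx
          have hy' := (hb.adj_left_iff' hT y).1 hy
          exact hb.adj_left y hy'.1 hy'.2
        · rw [Set.ncard_eq_one]
          exact ⟨q, Set.ext fun x => hb.adj_left_iff hT x⟩

/-- One further vertex gives the cyclic triangle; two of them are joined by an arc. -/
theorem IsBridge.exists_parityOk_or_exists_adj {T : Digraph V} {r q : V} (hb : T.IsBridge r q)
    (hT : T.IsTournament) (m : V → ZMod 2) :
    (∃ p ∈ T.degSpace, ∀ v, T.ParityOk m p v) ∨
      ∃ a b, T.Adj a b ∧ a ≠ r ∧ a ≠ q ∧ b ≠ r ∧ b ≠ q := by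
  obtain ⟨p, hpr, hpq⟩ := hb.exists_other
  by_cases h : ∀ v, v = r ∨ v = q ∨ v = p
  · exact Or.inl (hb.exists_parityOk_of_triangle hT hpr hpq h m)
  · right
    push Not at h
    obtain ⟨p', h1, h2, h3⟩ := h
    rcases hT.adj_or h3 with h | h
    · exact ⟨p', p, h, h1, h2, hpr, hpq⟩
    · exact ⟨p, p', h, hpr, hpq, h1, h2⟩

theorem IsTournament.weakOddColorable_three {T : Digraph V} (hT : T.IsTournament)
    (hC : T.SplitConnected) (m : V → ZMod 2)
    (h : ¬ ∃ p ∈ T.degSpace, ∀ v, T.ParityOk m p v) :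
    (∀ v, m v = 1) ∧ T.WeakOddColorable 3 := by
  obtain ⟨h1, h2, ⟨⟨s, hs⟩, h3⟩ | ⟨⟨s, hs⟩, h3⟩⟩ := hT.source_or_sink_of_splitConnected hC m h
  · exact ⟨h1, hT.weakOddColorable_three_of_source h2 hs h3⟩
  · exact ⟨h1, weakOddColorable_of_rev (hT.rev.weakOddColorable_three_of_source h2 hs h3)⟩

theorem IsTournament.defect_blowUp_le_one {T : Digraph V} (hT : T.IsTournament)
    (I : V → Type w) [∀ v, Fintype (I v)] [∀ v, Nonempty (I v)] :
    (T.blowUp I).defect ≤ 1 := by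
  by_cases h : ∃ p ∈ T.degSpace, ∀ v, T.ParityOk (fun v => (Fintype.card (I v) : ZMod 2)) p v
  · rw [(defect_eq_zero_iff _).2 ((T.weakOddColorable_blowUp_iff I).2 h)]
    exact zero_le_one
  · rcases hT.splitConnected_or_exists_isBridge with hC | ⟨r, q, hb⟩
    · by_cases ha : ∃ a b, T.Adj a b
      · obtain ⟨a, b, hab⟩ := ha
        obtain ⟨p, hp, hok⟩ := hC.exists_parityOk_except
          (fun v => (Fintype.card (I v) : ZMod 2)) hab
        exact T.defect_blowUp_le_one I hp a hok
      · refine absurd ⟨0, Submodule.zero_mem _, fun v => ⟨?_, ?_, ?_⟩⟩ h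
        · exact fun ⟨b, hb⟩ => absurd ⟨v, b, hb⟩ ha
        · exact fun ⟨b, hb⟩ => absurd ⟨b, v, hb⟩ ha
        · exact fun ⟨b, hb⟩ => absurd ⟨v, b, hb⟩ ha
    · obtain ⟨a, b, hab, har, haq, hbr, hbq⟩ :=
        (hb.exists_parityOk_or_exists_adj hT _).resolve_left h
      obtain ⟨p, hp, hok⟩ := hb.exists_parityOk_except hT hab har haq hbr hbq
        (fun v => (Fintype.card (I v) : ZMod 2))
      exact T.defect_blowUp_le_one I hp q hok

theorem IsTournament.not_weakOddColorable_of_isBadBlowUp {T : Digraph V} (hT : T.IsTournament)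
    (I : V → Type w) [∀ v, Fintype (I v)] [∀ v, Nonempty (I v)] (h : T.IsBadBlowUp I) :
    ¬ (T.blowUp I).WeakOddColorable 2 := by
  obtain ⟨r, q, hb, h1, h2, h3⟩ := (isBadBlowUp_iff_exists_isBridge hT I rfl).1 h
  rw [weakOddColorable_blowUp_iff]
  exact hb.not_exists_parityOk hT _ h1 h2 h3

theorem IsTournament.weakOddColorable_three_of_not {T : Digraph V} (hT : T.IsTournament)
    (I : V → Type w) [∀ v, Fintype (I v)] [∀ v, Nonempty (I v)]
    (h : ¬ (T.blowUp I).WeakOddColorable 2) (hbad : ¬ T.IsBadBlowUp I) :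
    (∀ v, Odd (Fintype.card (I v))) ∧ T.WeakOddColorable 3 := by
  rw [weakOddColorable_blowUp_iff] at h
  rcases hT.splitConnected_or_exists_isBridge with hC | ⟨r, q, hb⟩
  · obtain ⟨h1, h2⟩ := hT.weakOddColorable_three hC _ h
    exact ⟨fun v => ZMod.natCast_eq_one_iff_odd.1 (h1 v), h2⟩
  · obtain ⟨a, b, hab, har, haq, hbr, hbq⟩ :=
      (hb.exists_parityOk_or_exists_adj hT _).resolve_left h
    refine absurd (hb.exists_parityOk hT hab har haq hbr hbq _ fun hc => hbad ?_) h
    exact (isBadBlowUp_iff_exists_isBridge hT I rfl).2 ⟨r, q, hb, hc⟩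

end Digraph

end

theorem proposition4p7 {V : Type*} [Finite V] (T : Digraph V) (hT : T.IsTournament)
    (I : V → Type*) [∀ v, Finite (I v)] [∀ v, Nonempty (I v)] :
    ((((∀ v, Odd (Nat.card (I v))) ∧ T.weakOddIndex = 3) ∨ T.IsBadBlowUp I) →
      (T.blowUp I).defect = 1) ∧
    (¬ (((∀ v, Odd (Nat.card (I v))) ∧ T.weakOddIndex = 3) ∨ T.IsBadBlowUp I) →
      (T.blowUp I).defect = 0) := by
  have := Fintype.ofFinite V
  have := fun v => Fintype.ofFinite (I v)
  simp only [Nat.card_eq_fintype_card]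
  have hle := hT.defect_blowUp_le_one I
  have hcol := Digraph.defect_eq_zero_iff (T.blowUp I)
  constructor
  · intro h
    have hne : ¬ (T.blowUp I).WeakOddColorable 2 := by
      rcases h with ⟨hodd, hind⟩ | hbad
      · rw [T.weakOddColorable_blowUp_iff_of_odd I hodd]
        intro h2
        have : T.weakOddIndex ≤ 2 := Nat.sInf_le h2
        omega
      · exact hT.not_weakOddColorable_of_isBadBlowUp I hbad
    have := mt hcol.1 hne
    omega
  · intro h
    rw [not_or] at h
    rw [hcol]
    by_contra hne
    obtain ⟨hodd, h3⟩ := hT.weakOddColorable_three_of_not I hne h.2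
    rw [T.weakOddColorable_blowUp_iff_of_odd I hodd] at hne
    -- By monotonicity in the number of colors, an index below 3 would give a 2-coloring.
    refine h.1 ⟨hodd, le_antisymm (Nat.sInf_le h3) (le_csInf ⟨3, h3⟩ fun k hk => ?_)⟩
    by_contra hlt
    exact hne (hk.mono (by omega))
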